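/- Let $\tau,\lambda\in\mathbb R$ with $\tau\neq\pm\tfrac12$, and for $(n,m)\in\mathbb Z^2$ put $\mu=\mu_{n,m}=\tfrac14\left(1+2(-1)^{n+m}\tau\right)$. *Conventions.* $U\subseteq\mathbb C\setminus\{0\}$ is open and connected, $V\subseteq\mathbb C\setminus\{0\}$ is open, and holomorphic branches of the logarithm are fixed on $U$ and on $V$; they define $\sqrt y$ for $y\in U$ and $z^{\mu}$, $\sqrt z$ for $z\in V$. Lattice parameters $\alpha,\beta$ are complex numbers with $\alpha/\beta\in U$, $\alpha\beta\in V$ and $\sqrt{\alpha/\beta}\,\sqrt{\alpha\beta}=\alpha$ (for instance $\alpha,\beta>0$ with principal branches). Equations between meromorphic functions on $U$ are understood off a discrete set. $\mathcal P_{\rm VI}(a,b,c,d)$ is the sixth Painlevé equation $$G''=\tfrac12\Big(\tfrac1G+\tfrac1{G-1}+\tfrac1{G-y}\Big)G'^2-\Big(\tfrac1y+\tfrac1{y-1}+\tfrac1{G-y}\Big)G'+\tfrac{G(G-1)(G-y)}{y^2(y-1)^2}\Big(a+b\tfrac{y}{G^2}+c\tfrac{y-1}{(G-1)^2}+d\tfrac{y(y-1)}{(G-y)^2}\Big),$$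 and its solutions are not identically $0$, $1$ or $y$. H1 is the lattice equation $$(u_{n,m}-u_{n+1,m+1})(u_{n+1,m}-u_{n,m+1})-\alpha+\beta=0 .$$ A *continuously invariant solution* of H1 is a solution $u_{n,m}(\alpha,\beta)$, differentiable in $(\alpha,\beta)$, with $$(u_{n+1,m}-u_{n-1,m})\,\partial_\alpha u_{n,m}+n=0,\qquad (u_{n,m+1}-u_{n,m-1})\,\partial_\beta u_{n,m}+m=0 .$$ A *quadrature pair at $(n,m)$* is a pair $(S,H)$ of meromorphic functions on $U$ with $S\not\equiv0$, $H\not\equiv 0,1,y$ and $$\frac{d}{dy}\ln S=\frac{\mu_{n,m}}{y}\,\frac{y+H}{y-H}.$$ A *solution at $(n,m)$* is a quadrature pair at $(n,m)$ for which, moreover, $H$ solves $\mathcal P_{\rm VI}\left(\tfrac{n^2}2,-\tfrac{m^2}2,\lambda,\tfrac12-\tfrac18(1+2(-1)^{n+m}\tau)^2\right)$. The *shift relations* at $(n,m)$, with $\mu=\mu_{n,m}$, $S=S_{n,m}$, $H=H_{n,m}$, are $$S_{n+1,m}=\frac{y^2(y-1)^2H'^2+2(2\mu-1)y(y-1)H(H-1)H'+\sum_{i=0}^4A_iH^i}{8\mu(2\mu-1)\sqrt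 y\,(H-y)(H-1)H\,S},$$ $$S_{n,m+1}=\frac{y^2(y-1)^2H'^2+2(2\mu-1)y^2(y-1)(H-1)H'+\sum_{i=0}^4B_iH^i}{8\mu(2\mu-1)\sqrt y\,(H-y)(H-1)H\,S},$$ where, with $q=n-2\mu+1$, $$\begin{aligned}A_0(y,n,m)&=-m^2y^2,\\ A_1(y,n,m)&=y\left[(m^2-2\lambda+q^2)y+2m^2\right],\\ A_2(y,n,m)&=-q^2y^2-2(m^2-2\lambda+q^2)y+(1-2\mu)^2-m^2,\\ A_3(y,n,m)&=2q^2y+m^2+2n^2-2\lambda-(n+2\mu-1)^2,\\ A_4(y,n,m)&=-n(n-4\mu+2),\end{aligned}$$ and $B_i(y,n,m)=y^2A_{4-i}(y^{-1},m,n)$ (with the same $\mu$). A *$\mathcal P_{\rm VI}$ family* is a family $(S_{n,m},H_{n,m})_{(n,m)\in\mathbb Z^2}$ such that $(S_{n,m},H_{n,m})$ is a solution at $(n,m)$ for every $(n,m)$, with the same $\lambda$, and both shift relations hold at every $(n,m)$. **Theorem.** 1. For every $\mathcal P_{\rm VI}$ family, the function $$u_{n,m}(\alpha,\beta)=S_{n,m}\!\left(\tfrac\alpha\beta\right)(\alpha\beta)^{(1+2(-1)^{n+m}\tau)/4}$$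 is a continuously invariant solution of H1: the three equations hold at every $(n,m)$ and every $(\alpha,\beta)$ such that the functions $S$ at the six sites $(n,m),(n\pm1,m),(n,m\pm1),(n+1,m+1)$ are holomorphic at $\alpha/\beta$. 2. Such families exist: let $(S_0,H_0)$ be a solution at some site $(n_0,m_0)$, where $H_0$ satisfies no nontrivial polynomial relation $P(y,H_0,H_0')=0$ with coefficients in $\mathbb Q(\tau,\lambda)$. Then there is a $\mathcal P_{\rm VI}$ family with $S_{n_0,m_0}=S_0$ and $H_{n_0,m_0}=H_0$. 3. Let $(S,H)$ be a solution at $(n,m)$. If $S_{n+1,m}$ is given by the first shift relation and $(S_{n+1,m},H_{n+1,m})$ is a quadrature pair at $(n+1,m)$, then it is a solution at $(n+1,m)$, with the same $\lambda$. If $S_{n,m+1}$ is given by the second shift relation and $(S_{n,m+1},H_{n,m+1})$ is a quadrature pair at $(n,m+1)$, then it is a solution at $(n,m+1)$, with the same $\lambda$. -/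

import Mathlib

open Filter Topology

noncomputable section

/-- `L` is a holomorphic branch of the logarithm on `U`. -/
structure IsLogBranch (L : ℂ → ℂ) (U : Set ℂ) : Prop where
  differentiableOn : DifferentiableOn ℂ L U
  exp_eq : ∀ z ∈ U, Complex.exp (L z) = z

/-- The pairs of lattice parameters `(α, β)` with `α / β ∈ U` and `α β ∈ V` at which the chosen
branches are consistent, i.e. `√(α / β) √(α β) = α`. -/
def parameterDomain (L : ℂ → ℂ) (U : Set ℂ) (K : ℂ → ℂ) (V : Set ℂ) : Set (ℂ × ℂ) :=
  {p | p.1 / p.2 ∈ U ∧ p.1 * p.2 ∈ V ∧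
    Complex.exp (L (p.1 / p.2) / 2) * Complex.exp (K (p.1 * p.2) / 2) = p.1}

/-- The system that defines the continuously invariant solutions of H1, at the lattice site `(n, m)`
and the lattice parameters `(α, β)`: the equation H1 and the two invariant surface conditions
`∂u/∂α + n / (u(n+1,m) - u(n-1,m)) = 0` and `∂u/∂β + m / (u(n,m+1) - u(n,m-1)) = 0`.
The latter are written without denominators; for `n ≠ 0` (resp. `m ≠ 0`) the cleared form says in
particular that the denominator does not vanish. -/
structure IsContinuouslyInvariantH1At (u : ℤ → ℤ → ℂ → ℂ → ℂ) (n m : ℤ) (α β : ℂ) : Prop where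
  equation : (u n m α β - u (n + 1) (m + 1) α β) * (u (n + 1) m α β - u n (m + 1) α β)
    - α + β = 0
  differentiableAt : DifferentiableAt ℂ (fun p : ℂ × ℂ => u n m p.1 p.2) (α, β)
  invariant_n : (u (n + 1) m α β - u (n - 1) m α β) * deriv (fun a => u n m a β) α + n = 0
  invariant_m : (u n (m + 1) α β - u n (m - 1) α β) * deriv (fun b => u n m α b) β + m = 0

/-- The right-hand side of the sixth Painlevé equation `G'' = …`, with `G' = p`. -/
def painleveVIRhs (a b c d y G p : ℂ) : ℂ :=
  1 / 2 * (1 / G + 1 / (G - 1) + 1 / (G - y)) * p ^ 2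
    - (1 / y + 1 / (y - 1) + 1 / (G - y)) * p
    + G * (G - 1) * (G - y) / (y ^ 2 * (y - 1) ^ 2)
      * (a + b * (y / G ^ 2) + c * ((y - 1) / (G - 1) ^ 2) + d * (y * (y - 1) / (G - y) ^ 2))

/-- `G` is a meromorphic solution on `U` of the sixth Painlevé equation with parameters
`a, b, c, d`: off a discrete set, no denominator vanishes and the equation holds. -/
structure IsPainleveVISolution (U : Set ℂ) (a b c d : ℂ) (G : ℂ → ℂ) : Prop where
  meromorphicOn : MeromorphicOn G U
  nondegenerate : ∀ᶠ y in codiscreteWithin U, G y ≠ 0 ∧ G y ≠ 1 ∧ G y ≠ y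
  equation : ∀ᶠ y in codiscreteWithin U,
    deriv (deriv G) y = painleveVIRhs a b c d y (G y) (deriv G y)

/-- The exponent `μ = (1 + 2 (-1)^(n+m) τ) / 4`. -/
def exponent (τ : ℝ) (n m : ℤ) : ℂ := (1 + 2 * (-1) ^ (n + m) * (τ : ℂ)) / 4

/-- Meromorphic functions `S` and `H` on `U`, with `S` not identically zero and `H` not identically
`0`, `1` or `y`, that are related by the quadrature `(ln S)' = (μ / y) (y + H) / (y - H)`, where
`μ = (1 + 2 (-1)^(n+m) τ) / 4`. -/
structure IsQuadraturePair (U : Set ℂ) (τ : ℝ) (n m : ℤ) (S H : ℂ → ℂ) : Prop where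
  meromorphicOn_left : MeromorphicOn S U
  meromorphicOn_right : MeromorphicOn H U
  ne_zero : ∀ᶠ y in codiscreteWithin U, S y ≠ 0
  nondegenerate : ∀ᶠ y in codiscreteWithin U, H y ≠ 0 ∧ H y ≠ 1 ∧ H y ≠ y
  quadrature : ∀ᶠ y in codiscreteWithin U,
    logDeriv S y = exponent τ n m / y * ((y + H y) / (y - H y))

/-- `S` is given by the quadrature in `H`, and `H` solves the sixth Painlevé equation with
parameters `n²/2, -m²/2, λ, 1/2 - (1 + 2 (-1)^(n+m) τ)² / 8`. -/
structure IsSiteSolution (U : Set ℂ) (τ lam : ℝ) (n m : ℤ) (S H : ℂ → ℂ) : Prop where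
  pair : IsQuadraturePair U τ n m S H
  painleve : IsPainleveVISolution U ((n : ℂ) ^ 2 / 2) (-((m : ℂ) ^ 2) / 2) lam
    (1 / 2 - 1 / 8 * (1 + 2 * (-1) ^ (n + m) * (τ : ℂ)) ^ 2) H

/-- The coefficients `A₀, …, A₄` of the shift in `n`. -/
def coeffA (μ lam y : ℂ) (n m : ℤ) : Fin 5 → ℂ :=
  ![-(m : ℂ) ^ 2 * y ^ 2,
    y * ((m ^ 2 - 2 * lam + (n - 2 * μ + 1) ^ 2) * y + 2 * m ^ 2),
    -(n - 2 * μ + 1) ^ 2 * y ^ 2 - 2 * (m ^ 2 - 2 * lam + (n - 2 * μ + 1) ^ 2) * y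
      + (1 - 2 * μ) ^ 2 - m ^ 2,
    2 * (n - 2 * μ + 1) ^ 2 * y + m ^ 2 + 2 * n ^ 2 - 2 * lam - (n + 2 * μ - 1) ^ 2,
    -n * (n - 4 * μ + 2)]

/-- The coefficients `Bᵢ(y, n, m) = y² A₄₋ᵢ(1/y, m, n)` of the shift in `m`. -/
def coeffB (μ lam y : ℂ) (n m : ℤ) (i : Fin 5) : ℂ :=
  y ^ 2 * coeffA μ lam y⁻¹ m n i.rev

/-- The value of `S_{n+1,m}` at `y` in terms of `r = √y` and the values `h, p, s` of
`H_{n,m}, H_{n,m}', S_{n,m}`. -/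
def shiftN (μ lam : ℂ) (n m : ℤ) (y r h p s : ℂ) : ℂ :=
  (y ^ 2 * (y - 1) ^ 2 * p ^ 2 + 2 * (2 * μ - 1) * y * (y - 1) * h * (h - 1) * p
      + ∑ i : Fin 5, coeffA μ lam y n m i * h ^ (i : ℕ))
    / (8 * μ * (2 * μ - 1) * r * (h - y) * (h - 1) * h * s)

/-- The value of `S_{n,m+1}` at `y` in terms of `r = √y` and the values `h, p, s` of
`H_{n,m}, H_{n,m}', S_{n,m}`. -/
def shiftM (μ lam : ℂ) (n m : ℤ) (y r h p s : ℂ) : ℂ :=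
  (y ^ 2 * (y - 1) ^ 2 * p ^ 2 + 2 * (2 * μ - 1) * y ^ 2 * (y - 1) * (h - 1) * p
      + ∑ i : Fin 5, coeffB μ lam y n m i * h ^ (i : ℕ))
    / (8 * μ * (2 * μ - 1) * r * (h - y) * (h - 1) * h * s)

/-- The relation that expresses `S' = S_{n+1,m}` through `S = S_{n,m}` and `H = H_{n,m}`; here `√y`
is the branch `exp (L y / 2)`. -/
def IsShiftN (U : Set ℂ) (L : ℂ → ℂ) (τ lam : ℝ) (n m : ℤ) (S H S' : ℂ → ℂ) : Prop :=
  ∀ᶠ y in codiscreteWithin U,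
    S' y = shiftN (exponent τ n m) lam n m y (Complex.exp (L y / 2)) (H y) (deriv H y) (S y)

/-- The relation that expresses `S' = S_{n,m+1}` through `S = S_{n,m}` and `H = H_{n,m}`; here `√y`
is the branch `exp (L y / 2)`. -/
def IsShiftM (U : Set ℂ) (L : ℂ → ℂ) (τ lam : ℝ) (n m : ℤ) (S H S' : ℂ → ℂ) : Prop :=
  ∀ᶠ y in codiscreteWithin U,
    S' y = shiftM (exponent τ n m) lam n m y (Complex.exp (L y / 2)) (H y) (deriv H y) (S y)

/-- A family `(S_{n,m}, H_{n,m})` on the whole lattice, with one and the same `λ` at all sites, that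
is given by the quadrature and the sixth Painlevé equation at every site and is linked by the
explicit shift relations. -/
structure IsPainleveVIFamily (U : Set ℂ) (L : ℂ → ℂ) (τ lam : ℝ) (S H : ℤ → ℤ → ℂ → ℂ) :
    Prop where
  site : ∀ n m, IsSiteSolution U τ lam n m (S n m) (H n m)
  shift_n : ∀ n m, IsShiftN U L τ lam n m (S n m) (H n m) (S (n + 1) m)
  shift_m : ∀ n m, IsShiftM U L τ lam n m (S n m) (H n m) (S n (m + 1))

/-- `u(n,m) = S_{n,m}(α/β) (αβ)^((1 + 2 (-1)^(n+m) τ) / 4)`, the power being taken with the branch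
`K` of the logarithm. -/
def similaritySolution (K : ℂ → ℂ) (τ : ℝ) (S : ℤ → ℤ → ℂ → ℂ) (n m : ℤ) (α β : ℂ) : ℂ :=
  S n m (α / β) * Complex.exp (exponent τ n m * K (α * β))

/-- `H` is generic on `U`: it satisfies no nontrivial first-order algebraic differential equation
`P(y, H, H') = 0` whose coefficients lie in the field `ℚ(τ, λ)`. -/
def IsGeneric (U : Set ℂ) (τ lam : ℝ) (H : ℂ → ℂ) : Prop :=
  ∀ P : MvPolynomial (Fin 3) (IntermediateField.adjoin ℚ ({(τ : ℂ), (lam : ℂ)} : Set ℂ)),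
    P ≠ 0 → ¬ ∀ᶠ y in codiscreteWithin U, MvPolynomial.aeval ![y, H y, deriv H y] P = 0

end

/-! The whole statement is algebra in a differential field with a root r of y; analysis enters only
through a dictionary. Write h, s for H and S at (n, m), q = n - 2μ + 1, X for the momentum `momX`, Y
= X + q h, W = 2 q Y - (m² + q² - 2λ) (`linW`) and Z for `prodZ`. The first shift relation says that
Z is 8 μ (2μ - 1) r times the product of s and S_{n+1,m}. The definition of Z reads Z h (h - 1) = (h
- y)(Y² - m² - W h), so h is a root of a quadratic polynomial with leading coefficient Z + W and
values y (Y² - m²), (y - 1)((Y - q)² - 2λ), Z y (y - 1) at 0, 1, y.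

The quadrature for S_{n+1,m} says exactly that g = H_{n+1,m} is the other root, in the form of
Vieta's formula at y (`quadrature_iff`). In these terms P_VI is 2 y (y - 1) Y' = (Z + W)(h - g).
Differentiating Vieta's formula shows that the step from h to g turns Y into -Y (`momX_shift`).
Under the involution (n, μ, q, Y) → (-(n+1), 1/2 - μ, -q, -Y) the quantities Z and W are invariant,
while h - g changes sign; hence g solves P_VI and the step is reversible (`shift_site`).

P_VI depends on n only through n², so the step back from n is the step forward from -n. The
difference of the two steps gives the invariant surface condition (`shift_invariance`); Vieta's
formula at 0 and at y gives the lattice equation (`shift_latticeEquation`). Inverting y and h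
exchanges n and m, which yields all statements about m. The lattice equation determines the fourth
corner of a square from the other three, so the two shifts commute (`IsLatticeSite.shift_comm`).

For existence, algebraic independence of y, h, h' keeps the second root away from 0, 1, y, and it is
inherited by g because y, g, g' generate a field containing h and h' (`exists_shiftFst`).
Meromorphic functions modulo equality off discrete sets form such a differential field, and u solves
H1 because exponents at neighbouring sites add up to 1/2. -/

section Algebraic

/-! ### The sixth Painlevé equation in momentum form -/

variable {k F : Type*} [Field k] [Field F] [Algebra k F]

/-- The right-hand side of the sixth Painlevé equation over a field. -/
def pviRhs (a b c d y G p : F) : F :=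
  1 / 2 * (1 / G + 1 / (G - 1) + 1 / (G - y)) * p ^ 2
    - (1 / y + 1 / (y - 1) + 1 / (G - y)) * p
    + G * (G - 1) * (G - y) / (y ^ 2 * (y - 1) ^ 2)
      * (a + b * (y / G ^ 2) + c * ((y - 1) / (G - 1) ^ 2) + d * (y * (y - 1) / (G - y) ^ 2))

/-- The momentum `X` conjugate to `h`, where `p` is the derivative of `h`. -/
def momX (μ y h p : F) : F := (y * (y - 1) * p + (2 * μ - 1) * h * (h - 1)) / (h - y)

/-- The quadratic polynomial `q² h² - κ h + m²` with `κ = m² + q² - 2 λ`. -/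
def quadQ (q m lam h : F) : F := q ^ 2 * h ^ 2 - (m ^ 2 + q ^ 2 - 2 * lam) * h + m ^ 2

/-- The product of neighbouring values of `S`, up to a constant and `√y`. -/
def prodZ (q m lam y h X : F) : F := (h - y) * (X ^ 2 - quadQ q m lam h) / (h * (h - 1))

/-- The quantity `2 q (X + q h) - κ`. -/
def linW (q m lam h X : F) : F := 2 * q * (X + q * h) - (m ^ 2 + q ^ 2 - 2 * lam)

theorem Derivation.map_div (D : Derivation k F F) (a b : F) (hb : b ≠ 0) :
    D (a / b) = (D a * b - a * D b) / b ^ 2 := by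
  rw [Derivation.leibniz_div]
  simp only [smul_eq_mul]
  field_simp

theorem Derivation.map_two (D : Derivation k F F) : D 2 = 0 := by
  exact_mod_cast D.map_natCast 2

/-- The sixth Painlevé equation as a first order equation for the momentum `X`. -/
theorem pvi_iff_momX [CharZero F] (D : Derivation k F F) {y n m μ lam h : F} (hy : D y = 1) (hy0 : y ≠ 0)
    (hy1 : y ≠ 1) (h0 : h ≠ 0) (h1 : h ≠ 1) (hhy : h ≠ y) (hμ : D μ = 0) :
    D (D h) = pviRhs (n ^ 2 / 2) (-m ^ 2 / 2) lam (1 / 2 - 2 * μ ^ 2) y h (D h) ↔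
    y * (y - 1) * D (momX μ y h (D h)) =
      momX μ y h (D h) ^ 2 * (h ^ 2 - 2 * h * y + y) / (2 * h * (h - 1))
        + h * (h - 1) * (n ^ 2 - (2 * μ - 1) ^ 2) / 2 - m ^ 2 * y * (h - 1) / (2 * h)
        + lam * (y - 1) * h / (h - 1) := by
  have e1 : h - 1 ≠ 0 := sub_ne_zero.2 h1
  have ey : h - y ≠ 0 := sub_ne_zero.2 hhy
  have y1 : y - 1 ≠ 0 := sub_ne_zero.2 hy1
  -- The defects of the two equations differ by the factor y² (y - 1)² / (h - y), which does not
  -- vanish.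
  have key : y * (y - 1) * D (momX μ y h (D h)) -
      (momX μ y h (D h) ^ 2 * (h ^ 2 - 2 * h * y + y) / (2 * h * (h - 1))
        + h * (h - 1) * (n ^ 2 - (2 * μ - 1) ^ 2) / 2 - m ^ 2 * y * (h - 1) / (2 * h)
        + lam * (y - 1) * h / (h - 1)) = y ^ 2 * (y - 1) ^ 2 / (h - y) *
      (D (D h) - pviRhs (n ^ 2 / 2) (-m ^ 2 / 2) lam (1 / 2 - 2 * μ ^ 2) y h (D h)) := by
    simp only [momX, pviRhs]
    rw [D.map_div _ _ ey]
    simp only [map_add, map_sub, Derivation.leibniz, smul_eq_mul, hy, hμ,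
      Derivation.map_one_eq_zero, Derivation.map_two]
    generalize D (D h) = b
    generalize D h = p
    field_simp
    ring
  rw [← sub_eq_zero, ← sub_eq_zero (a := y * (y - 1) * _), key, mul_eq_zero]
  have : y ^ 2 * (y - 1) ^ 2 / (h - y) ≠ 0 := by positivity
  simp [this]

/-- The sixth Painlevé equation as a first order equation for `X + q h`. -/
theorem pvi_iff [CharZero F] (D : Derivation k F F) {y n m μ lam h q : F} (hy : D y = 1) (hy0 : y ≠ 0)
    (hy1 : y ≠ 1) (h0 : h ≠ 0) (h1 : h ≠ 1) (hhy : h ≠ y) (hμ : D μ = 0) (hn : D n = 0)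
    (hq : q = n - 2 * μ + 1) :
    D (D h) = pviRhs (n ^ 2 / 2) (-m ^ 2 / 2) lam (1 / 2 - 2 * μ ^ 2) y h (D h) ↔
    2 * (y * (y - 1)) * D (momX μ y h (D h) + q * h) =
      prodZ q m lam y h (momX μ y h (D h)) * (h ^ 2 - 2 * h * y + y) / (h - y)
        + linW q m lam h (momX μ y h (D h)) * (h - y) := by
  rw [pvi_iff_momX D hy hy0 hy1 h0 h1 hhy hμ]
  have e1 : h - 1 ≠ 0 := sub_ne_zero.2 h1
  have ey : h - y ≠ 0 := sub_ne_zero.2 hhy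
  have y1 : y - 1 ≠ 0 := sub_ne_zero.2 hy1
  have hD : D q = 0 := by simp [hq, hμ, hn, Derivation.map_two]
  have hp : y * (y - 1) * D h = (h - y) * momX μ y h (D h) - (2 * μ - 1) * h * (h - 1) := by
    rw [momX]; field_simp; ring
  generalize momX μ y h (D h) = X at *
  simp only [map_add, Derivation.leibniz, smul_eq_mul, hD, mul_zero, add_zero]
  rw [show 2 * (y * (y - 1)) * (D X + q * D h) = 2 * (y * (y - 1) * D X) + 2 * q *
    ((h - y) * X - (2 * μ - 1) * h * (h - 1)) by rw [← hp]; ring]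
  generalize y * (y - 1) * D X = t
  simp only [prodZ, linW, quadQ, hq]
  constructor <;> intro h
  · rw [h]; field_simp; ring
  · rw [← sub_eq_zero] at h ⊢
    rw [← mul_eq_zero_iff_left (two_ne_zero (α := F)), ← h]
    field_simp; ring

end Algebraic

/-! ### The shift in n and the quadrature in a differential field -/

section Algebraic

variable {k F : Type*} [Field k] [Field F] [Algebra k F]

/-- The constants and the independent variable `y`, with a square root `r`, of a lattice site in
a differential field. -/
structure IsSetting (D : Derivation k F F) (y r n m μ lam : F) : Prop where
  deriv_y : D y = 1
  y_ne_zero : y ≠ 0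
  y_ne_one : y ≠ 1
  sq_r : r ^ 2 = y
  deriv_n : D n = 0
  deriv_m : D m = 0
  deriv_μ : D μ = 0
  deriv_lam : D lam = 0
  μ_ne_zero : μ ≠ 0
  ν_ne_zero : 2 * μ - 1 ≠ 0

/-- A quadrature pair in a differential field. -/
structure IsPair (D : Derivation k F F) (y μ s h : F) : Prop where
  s_ne_zero : s ≠ 0
  h_ne_zero : h ≠ 0
  h_ne_one : h ≠ 1
  h_ne_y : h ≠ y
  quadrature : D s / s = μ / y * ((y + h) / (y - h))

/-- The sixth Painlevé equation of a lattice site in a differential field. -/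
def IsPVI (D : Derivation k F F) (y n m μ lam h : F) : Prop :=
  D (D h) = pviRhs (n ^ 2 / 2) (-m ^ 2 / 2) lam (1 / 2 - 2 * μ ^ 2) y h (D h)

/-- The shift in `n`. -/
def shiftFst (n m μ lam y r h p s : F) : F :=
  ((y * (y - 1) * p + (2 * μ - 1) * h * (h - 1)) ^ 2
      - (h - y) ^ 2 * quadQ (n - 2 * μ + 1) m lam h)
    / (8 * μ * (2 * μ - 1) * r * (h - y) * (h - 1) * h * s)

theorem IsSetting.r_ne_zero {D : Derivation k F F} {y r n m μ lam : F}
    (hS : IsSetting D y r n m μ lam) : r ≠ 0 := by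
  rintro rfl
  exact hS.y_ne_zero (by rw [← hS.sq_r]; simp)

/-- The numerator of the shift is (h - y)² (X² - Q(h)), with Q = `quadQ`; so Z is, up to a constant
and r, the product of the two neighbouring values of S. -/
theorem shiftFst_eq (n m μ lam y r h p s : F) (h0 : h ≠ 0) (h1 : h ≠ 1) (hy : h ≠ y) :
    shiftFst n m μ lam y r h p s =
      prodZ (n - 2 * μ + 1) m lam y h (momX μ y h p) / (8 * μ * (2 * μ - 1) * r * s) := by
  have e1 : h - 1 ≠ 0 := sub_ne_zero.2 h1
  have ey : h - y ≠ 0 := sub_ne_zero.2 hy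
  simp only [shiftFst, prodZ, momX]
  field_simp

/-- Reversing a step is the involution (n, μ) → (-(n + 1), 1/2 - μ). It sends q to -q and exchanges
the conditions μ ≠ 0 and 2μ - 1 ≠ 0. -/
theorem IsSetting.neg_succ [CharZero F] {D : Derivation k F F} {y r n m μ lam : F}
    (hS : IsSetting D y r n m μ lam) : IsSetting D y r (-(n + 1)) m (1 / 2 - μ) lam where
  deriv_y := hS.deriv_y
  y_ne_zero := hS.y_ne_zero
  y_ne_one := hS.y_ne_one
  sq_r := hS.sq_r
  deriv_n := by simp [hS.deriv_n]
  deriv_m := hS.deriv_m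
  deriv_μ := by
    rw [map_sub, hS.deriv_μ, D.map_div _ _ two_ne_zero]; simp [Derivation.map_two]
  deriv_lam := hS.deriv_lam
  μ_ne_zero h := hS.ν_ne_zero (by linear_combination -2 * h)
  ν_ne_zero h := hS.μ_ne_zero (by linear_combination -h / 2)

/-- The derivative of `h` in terms of the momentum. -/
theorem deriv_eq_momX (D : Derivation k F F) {y μ h : F} (hy : h ≠ y) :
    y * (y - 1) * D h = (h - y) * momX μ y h (D h) - (2 * μ - 1) * h * (h - 1) := by
  have ey : h - y ≠ 0 := sub_ne_zero.2 hy
  rw [momX]; field_simp; ring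

/-- Eliminating h' by the definition of X and X' by P_VI leaves an expression linear in Z and W.
This is the only input from P_VI needed to compare logarithmic derivatives in `quadrature_iff`. -/
theorem deriv_prodZ [CharZero F] {D : Derivation k F F} {y r n m μ lam h : F}
    (hS : IsSetting D y r n m μ lam) (h0 : h ≠ 0) (h1 : h ≠ 1) (hy : h ≠ y)
    (hP : IsPVI D y n m μ lam h) :
    y * (y - 1) * D (prodZ (n - 2 * μ + 1) m lam y h (momX μ y h (D h))) =
      prodZ (n - 2 * μ + 1) m lam y h (momX μ y h (D h))
        * ((2 * μ - 1) * (h ^ 2 - 2 * h * y + y) - y * (y - 1)) / (h - y)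
      + (2 * μ - 1) * (h - y) * linW (n - 2 * μ + 1) m lam h (momX μ y h (D h)) := by
  have e1 : h - 1 ≠ 0 := sub_ne_zero.2 h1
  have ey : h - y ≠ 0 := sub_ne_zero.2 hy
  have y0 := hS.y_ne_zero
  have y1 : y - 1 ≠ 0 := sub_ne_zero.2 hS.y_ne_one
  have hX := (pvi_iff_momX D hS.deriv_y y0 hS.y_ne_one h0 h1 hy hS.deriv_μ).1 hP
  have hp := deriv_eq_momX D (μ := μ) hy
  generalize momX μ y h (D h) = X at *
  have hX' := eq_div_of_mul_eq (mul_ne_zero y0 y1) ((mul_comm _ _).trans hX)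
  have hp' := eq_div_of_mul_eq (mul_ne_zero y0 y1) ((mul_comm _ _).trans hp)
  simp only [prodZ, quadQ]
  rw [D.map_div _ _ (mul_ne_zero h0 e1)]
  simp only [map_add, map_sub, Derivation.leibniz, Derivation.leibniz_pow, smul_eq_mul, hS.deriv_y,
    hS.deriv_μ, hS.deriv_n, hS.deriv_m, hS.deriv_lam, Derivation.map_one_eq_zero,
    Derivation.map_two, nsmul_eq_mul]
  rw [hX', hp']
  simp only [linW]
  push_cast
  clear hX' hp' hX hp
  field_simp
  ring

/-- The quadrature for the shifted solution `(t, g)` is an algebraic relation. -/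
theorem quadrature_iff [CharZero F] {D : Derivation k F F} {y r n m μ lam s h t g : F}
    (hS : IsSetting D y r n m μ lam) (hp : IsPair D y μ s h) (hP : IsPVI D y n m μ lam h)
    (ht : t = shiftFst n m μ lam y r h (D h) s) (ht0 : t ≠ 0) (hg : g ≠ y) :
    D t / t = (1 / 2 - μ) / y * ((y + g) / (y - g)) ↔
    prodZ (n - 2 * μ + 1) m lam y h (momX μ y h (D h)) * (y * (y - 1)) =
      (h - y) * (g - y) * (prodZ (n - 2 * μ + 1) m lam y h (momX μ y h (D h))
        + linW (n - 2 * μ + 1) m lam h (momX μ y h (D h))) := by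
  have ey : h - y ≠ 0 := sub_ne_zero.2 hp.h_ne_y
  have ey' : y - h ≠ 0 := sub_ne_zero.2 hp.h_ne_y.symm
  have y0 := hS.y_ne_zero
  have y1 : y - 1 ≠ 0 := sub_ne_zero.2 hS.y_ne_one
  have eg : g - y ≠ 0 := sub_ne_zero.2 hg
  have eg' : y - g ≠ 0 := sub_ne_zero.2 hg.symm
  have s0 := hp.s_ne_zero
  have r0 := hS.r_ne_zero
  have μ0 := hS.μ_ne_zero
  have ν0 := hS.ν_ne_zero
  have hZ := deriv_prodZ hS hp.h_ne_zero hp.h_ne_one hp.h_ne_y hP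
  rw [shiftFst_eq _ _ _ _ _ _ _ _ _ hp.h_ne_zero hp.h_ne_one hp.h_ne_y] at ht
  generalize linW (n - 2 * μ + 1) m lam h (momX μ y h (D h)) = W at *
  generalize prodZ (n - 2 * μ + 1) m lam y h (momX μ y h (D h)) = Z at *
  have hZt : Z = 8 * μ * (2 * μ - 1) * (r * s * t) := by
    rw [ht]
    have : μ * 2 - 1 ≠ 0 := by rwa [mul_comm]
    field_simp
  have hr : D r = r / (2 * y) := by
    have := congrArg D hS.sq_r
    simp only [Derivation.leibniz_pow, hS.deriv_y, smul_eq_mul, nsmul_eq_mul] at this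
    rw [eq_div_iff (by simp [y0]), ← hS.sq_r]
    push_cast at this
    linear_combination r * this
  have hs : D s = s * (μ / y * ((y + h) / (y - h))) := by rw [← hp.quadrature]; field_simp
  have hDZ : D Z = 8 * μ * (2 * μ - 1) * (r / (2 * y) * s * t
      + r * (s * (μ / y * ((y + h) / (y - h)))) * t + r * s * D t) := by
    have h8 : D 8 = 0 := by exact_mod_cast D.map_natCast 8
    rw [hZt, ← hs, ← hr]
    simp only [map_sub, Derivation.leibniz, smul_eq_mul, hS.deriv_μ, h8, Derivation.map_two,
      Derivation.map_one_eq_zero]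
    ring
  -- E is the defect of the quadrature for (t, g). In the logarithmic derivative of Z = 8 μ (2μ - 1)
  -- r s t, the term 1 / (2y) from r cancels the 1 / y parts of the two quadratures; the pole at h =
  -- y then matches that in `deriv_prodZ`, and E is proportional to the defect of the algebraic
  -- relation.
  obtain ⟨E, hE⟩ : ∃ E, D t / t = E + (1 / 2 - μ) / y * ((y + g) / (y - g)) :=
    ⟨D t / t - (1 / 2 - μ) / y * ((y + g) / (y - g)), by ring⟩
  have ht' : D t = t * (E + (1 / 2 - μ) / y * ((y + g) / (y - g))) := by rw [← hE]; field_simp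
  have hDZ' : D Z = Z * (1 / (2 * y) + μ / y * ((y + h) / (y - h)) + E
      + (1 / 2 - μ) / y * ((y + g) / (y - g))) := by
    rw [hDZ, hZt, ht']; ring
  have key : Z * (y * (y - 1)) * E = (2 * μ - 1) * ((h - y) * (Z + W)
      - Z * (y * (y - 1)) / (g - y)) := by
    have h2 : y * (y - 1) * D Z = Z * (y * (y - 1)) * E + Z * ((2 * μ - 1) * y * (y - 1) / (g - y)
        - (2 * μ) * y * (y - 1) / (h - y)) := by
      rw [hDZ', ← neg_sub h y, ← neg_sub g y]; field_simp; ring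
    rw [h2] at hZ
    rw [← sub_eq_zero] at hZ ⊢
    rw [← hZ]
    field_simp
    ring
  have hZ0 : Z ≠ 0 := by rw [hZt]; simp [hS.μ_ne_zero, ν0, r0, s0, ht0]
  rw [hE, add_eq_right, ← mul_eq_zero_iff_left (mul_ne_zero hZ0 (mul_ne_zero y0 y1)), key,
    mul_eq_zero_iff_left ν0, sub_eq_zero, eq_div_iff eg]
  constructor <;> intro h <;> rw [← sub_eq_zero] at h ⊢ <;> rw [← neg_eq_zero, ← h] <;> ring

end Algebraic

/-! ### The shift as exchange of the two roots of a quadratic polynomial -/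

section Algebraic

variable {k F : Type*} [Field k] [Field F] [Algebra k F]

/-- The new momentum is q g - X - q h, so X + q h changes sign together with q, and W depends only
on their product and on q². -/
theorem linW_neg (q m lam h g X : F) :
    linW (-q) m lam g (q * g - X - q * h) = linW q m lam h X := by
  simp only [linW]; ring

/-- A relation between `h` and `g` that is solved by the two roots of a quadratic equation. -/
theorem prodZ_neg {q m lam y h g X : F} (h0 : h ≠ 0) (h1 : h ≠ 1) (hy : h ≠ y)
    (g0 : g ≠ 0) (g1 : g ≠ 1) (gy : g ≠ y)
    (hrel : prodZ q m lam y h X * (y * (y - 1)) =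
      (h - y) * (g - y) * (prodZ q m lam y h X + linW q m lam h X)) :
    prodZ (-q) m lam y g (q * g - X - q * h) = prodZ q m lam y h X := by
  have e1 : h - 1 ≠ 0 := sub_ne_zero.2 h1
  have ey : h - y ≠ 0 := sub_ne_zero.2 hy
  have f1 : g - 1 ≠ 0 := sub_ne_zero.2 g1
  have fy : g - y ≠ 0 := sub_ne_zero.2 gy
  have hX : prodZ q m lam y h X * (h * (h - 1)) = (h - y) * (X ^ 2 - quadQ q m lam h) := by
    simp only [prodZ]; field_simp
  generalize prodZ q m lam y h X = Z at *
  simp only [prodZ]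
  rw [div_eq_iff (mul_ne_zero g0 f1)]
  refine mul_right_cancel₀ ey ?_
  simp only [quadQ, linW] at *
  linear_combination -(g - y) * hX + (g - h) * hrel

/-- Differentiating the relation between h and g gives a linear equation for g', since h', Z' and (X
+ q h)' are known from P_VI. Solved for g', it says that Y changes sign. -/
theorem momX_shift [CharZero F] {D : Derivation k F F} {y r n m μ lam s h g : F}
    (hS : IsSetting D y r n m μ lam) (hp : IsPair D y μ s h) (hP : IsPVI D y n m μ lam h)
    (hZ0 : prodZ (n - 2 * μ + 1) m lam y h (momX μ y h (D h)) ≠ 0) (gy : g ≠ y)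
    (hrel : prodZ (n - 2 * μ + 1) m lam y h (momX μ y h (D h)) * (y * (y - 1)) =
      (h - y) * (g - y) * (prodZ (n - 2 * μ + 1) m lam y h (momX μ y h (D h))
        + linW (n - 2 * μ + 1) m lam h (momX μ y h (D h)))) :
    momX (1 / 2 - μ) y g (D g) =
      (n - 2 * μ + 1) * g - momX μ y h (D h) - (n - 2 * μ + 1) * h := by
  have ey : h - y ≠ 0 := sub_ne_zero.2 hp.h_ne_y
  have y0 := hS.y_ne_zero
  have y1 : y - 1 ≠ 0 := sub_ne_zero.2 hS.y_ne_one
  have eg : g - y ≠ 0 := sub_ne_zero.2 gy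
  have hZ := deriv_prodZ hS hp.h_ne_zero hp.h_ne_one hp.h_ne_y hP
  have hh := deriv_eq_momX D (μ := μ) hp.h_ne_y
  have hY := (pvi_iff D hS.deriv_y y0 hS.y_ne_one hp.h_ne_zero hp.h_ne_one hp.h_ne_y hS.deriv_μ
    hS.deriv_n rfl).1 hP
  have hq : D (n - 2 * μ + 1) = 0 := by simp [hS.deriv_n, hS.deriv_μ, Derivation.map_two]
  have hW : D (linW (n - 2 * μ + 1) m lam h (momX μ y h (D h))) =
      2 * (n - 2 * μ + 1) * D (momX μ y h (D h) + (n - 2 * μ + 1) * h) := by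
    simp only [linW]
    rw [map_sub, Derivation.leibniz, Derivation.leibniz]
    simp [hq, hS.deriv_m, hS.deriv_lam, Derivation.map_two]
  rw [momX, div_eq_iff eg]
  have hDrel := congrArg D hrel
  generalize hZZ : prodZ (n - 2 * μ + 1) m lam y h (momX μ y h (D h)) = Z at *
  generalize hWW : linW (n - 2 * μ + 1) m lam h (momX μ y h (D h)) = W at *
  simp only [Derivation.leibniz, map_add, map_sub, hS.deriv_y, smul_eq_mul, hW,
    Derivation.map_one_eq_zero] at hDrel
  have hY' := eq_div_of_mul_eq (mul_ne_zero two_ne_zero (mul_ne_zero y0 y1))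
    ((mul_comm _ _).trans hY)
  have hZ' := eq_div_of_mul_eq (mul_ne_zero y0 y1) ((mul_comm _ _).trans hZ)
  have hh' := eq_div_of_mul_eq (mul_ne_zero y0 y1) ((mul_comm _ _).trans hh)
  simp only [map_add, Derivation.leibniz, hq, smul_eq_mul, mul_zero, add_zero] at hY'
  simp only [Derivation.map_two, hS.deriv_n, hS.deriv_μ] at hDrel
  have hWr : W = Z * (y * (y - 1)) / ((h - y) * (g - y)) - Z := by rw [hrel]; field_simp; ring
  have hA : Z * (y * (y - 1)) ≠ 0 := mul_ne_zero hZ0 (mul_ne_zero y0 y1)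
  -- The derivative of the relation is the claim times Z y (y - 1) / (g - y), after W has been
  -- eliminated by the relation itself.
  have key : Z * (y * (y - 1)) / (g - y) * (y * (y - 1) * D g + (2 * (1 / 2 - μ) - 1) * g * (g - 1)
      - ((n - 2 * μ + 1) * g - momX μ y h (D h) - (n - 2 * μ + 1) * h) * (g - y)) = 0 := by
    rw [← sub_eq_zero] at hDrel
    rw [← mul_zero (y * (y - 1)), ← neg_zero, ← hDrel]
    have hY2 : D (momX μ y h (D h)) = (Z * (h ^ 2 - 2 * h * y + y) / (h - y) + W * (h - y))
      / (2 * (y * (y - 1))) - (n - 2 * μ + 1) * D h := by rw [← hY']; ring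
    rw [hZ', hY2]
    generalize momX μ y h (D h) = X at *
    rw [hh', hWr]
    generalize D g = G
    field_simp
    ring
  have := (mul_eq_zero_iff_left (div_ne_zero hA eg)).1 key
  linear_combination this

/-- Shifting preserves the sixth Painlevé equation, and the shift is reversible. -/
theorem shift_site [CharZero F] {D : Derivation k F F} {y r n m μ lam s h t g : F}
    (hS : IsSetting D y r n m μ lam) (hp : IsPair D y μ s h) (hP : IsPVI D y n m μ lam h)
    (ht : t = shiftFst n m μ lam y r h (D h) s) (hp' : IsPair D y (1 / 2 - μ) t g) :
    momX (1 / 2 - μ) y g (D g) =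
      (n - 2 * μ + 1) * g - momX μ y h (D h) - (n - 2 * μ + 1) * h ∧
    IsPVI D y (n + 1) m (1 / 2 - μ) lam g ∧
    s = shiftFst (-(n + 1)) m (1 / 2 - μ) lam y r g (D g) t := by
  have hrel := (quadrature_iff hS hp hP ht hp'.s_ne_zero hp'.h_ne_y).1 hp'.quadrature
  have ht' := ht
  rw [shiftFst_eq _ _ _ _ _ _ _ _ _ hp.h_ne_zero hp.h_ne_one hp.h_ne_y] at ht'
  have hZ0 : prodZ (n - 2 * μ + 1) m lam y h (momX μ y h (D h)) ≠ 0 := by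
    intro h0
    exact hp'.s_ne_zero (by rw [ht', h0, zero_div])
  have hX := momX_shift hS hp hP hZ0 hp'.h_ne_y hrel
  have hZ := prodZ_neg hp.h_ne_zero hp.h_ne_one hp.h_ne_y hp'.h_ne_zero hp'.h_ne_one hp'.h_ne_y
    hrel
  have hW := linW_neg (n - 2 * μ + 1) m lam h g (momX μ y h (D h))
  rw [← hX] at hZ hW
  have hS' := hS.neg_succ
  have hq : -(n - 2 * μ + 1) = -(n + 1) - 2 * (1 / 2 - μ) + 1 := by ring
  refine ⟨hX, ?_, ?_⟩
  -- At -(n + 1) the parameter q becomes exactly -q; the sign of n + 1 is dropped at the end, since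
  -- only its square occurs in P_VI.
  · have : IsPVI D y (-(n + 1)) m (1 / 2 - μ) lam g := by
      refine (pvi_iff D hS'.deriv_y hS'.y_ne_zero hS'.y_ne_one hp'.h_ne_zero hp'.h_ne_one
        hp'.h_ne_y hS'.deriv_μ hS'.deriv_n hq).2 ?_
      have hY := (pvi_iff D hS.deriv_y hS.y_ne_zero hS.y_ne_one hp.h_ne_zero hp.h_ne_one hp.h_ne_y
        hS.deriv_μ hS.deriv_n rfl).1 hP
      rw [hZ, hW, show momX (1 / 2 - μ) y g (D g) + -(n - 2 * μ + 1) * g =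
        -(momX μ y h (D h) + (n - 2 * μ + 1) * h) by rw [hX]; ring, map_neg, mul_neg, hY]
      have ey : h - y ≠ 0 := sub_ne_zero.2 hp.h_ne_y
      have eg : g - y ≠ 0 := sub_ne_zero.2 hp'.h_ne_y
      generalize prodZ (n - 2 * μ + 1) m lam y h (momX μ y h (D h)) = Z at *
      generalize linW (n - 2 * μ + 1) m lam h (momX μ y h (D h)) = W at *
      -- Since h² - 2hy + y = (h - y)² - y (y - 1), the relation turns the right-hand side of
      -- `pvi_iff` into (Z + W)(h - g), which is antisymmetric in h and g.
      rw [← sub_eq_zero, ← mul_eq_zero_iff_left (mul_ne_zero ey eg)]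
      field_simp
      linear_combination (h + g - 2 * y) * hrel
    simpa only [IsPVI, neg_sq] using this
  · rw [shiftFst_eq _ _ _ _ _ _ _ _ _ hp'.h_ne_zero hp'.h_ne_one hp'.h_ne_y, ← hq, hZ]
    have r0 := hS.r_ne_zero
    have s0 := hp.s_ne_zero
    have t0 := hp'.s_ne_zero
    have μ0 := hS.μ_ne_zero
    have ν0 := hS.ν_ne_zero
    -- The constant μ (2μ - 1) is invariant under μ → 1/2 - μ, so the same product Z gives back s.
    have c0 : 8 * (1 / 2 - μ) * (2 * (1 / 2 - μ) - 1) * r * t ≠ 0 := by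
      have := hS'.μ_ne_zero
      have := hS'.ν_ne_zero
      simp_all
    have c1 : 8 * μ * (2 * μ - 1) * r * s ≠ 0 := by simp_all
    rw [eq_div_iff c0]
    rw [eq_div_iff c1] at ht'
    rw [← ht']
    ring

end Algebraic

/-! ### Inversion of y, the invariant surface conditions and the lattice equation -/

section Algebraic

variable {k F : Type*} [Field k] [Field F] [Algebra k F]

/-- The derivation with respect to `1 / y`. -/
def Derivation.invVar (D : Derivation k F F) (y : F) : Derivation k F F := (-y ^ 2) • D

@[simp]
theorem Derivation.invVar_apply (D : Derivation k F F) (y a : F) :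
    D.invVar y a = -y ^ 2 * D a := rfl

theorem Derivation.map_inv (D : Derivation k F F) (a : F) : D a⁻¹ = -D a / a ^ 2 := by
  rw [Derivation.leibniz_inv]
  simp only [smul_eq_mul]
  field_simp

theorem Derivation.invVar_invVar (D : Derivation k F F) {y : F} (hy : y ≠ 0) :
    (D.invVar y).invVar y⁻¹ = D := by
  ext a
  simp only [Derivation.invVar_apply]
  field_simp

/-- The shift in `m`, obtained from the shift in `n` by inverting `y` and `h`. -/
def shiftSnd (n m μ lam y r h p s : F) : F :=
  shiftFst m n μ lam y⁻¹ r⁻¹ h⁻¹ (y ^ 2 * p / h ^ 2) s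

theorem IsSetting.dual {D : Derivation k F F} {y r n m μ lam : F}
    (hS : IsSetting D y r n m μ lam) : IsSetting (D.invVar y) y⁻¹ r⁻¹ m n μ lam where
  deriv_y := by
    have := hS.y_ne_zero
    rw [Derivation.invVar_apply, D.map_inv, hS.deriv_y]
    field_simp
  y_ne_zero := inv_ne_zero hS.y_ne_zero
  y_ne_one := by simpa using hS.y_ne_one
  sq_r := by rw [inv_pow, hS.sq_r]
  deriv_n := by simp [hS.deriv_m]
  deriv_m := by simp [hS.deriv_n]
  deriv_μ := by simp [hS.deriv_μ]
  deriv_lam := by simp [hS.deriv_lam]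
  μ_ne_zero := hS.μ_ne_zero
  ν_ne_zero := hS.ν_ne_zero

theorem IsPair.dual {D : Derivation k F F} {y μ s h : F} (hy : y ≠ 0) (hp : IsPair D y μ s h) :
    IsPair (D.invVar y) y⁻¹ μ s h⁻¹ where
  s_ne_zero := hp.s_ne_zero
  h_ne_zero := inv_ne_zero hp.h_ne_zero
  h_ne_one := by simpa using hp.h_ne_one
  h_ne_y := by simpa using hp.h_ne_y
  quadrature := by
    have h0 := hp.h_ne_zero
    have e1 : y - h ≠ 0 := sub_ne_zero.2 hp.h_ne_y.symm
    have e2 : h - y ≠ 0 := sub_ne_zero.2 hp.h_ne_y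
    rw [Derivation.invVar_apply, mul_div_assoc, hp.quadrature,
      show y⁻¹ - h⁻¹ = (h - y) / (y * h) by field_simp, ← neg_sub h y]
    field_simp
    ring

/-- Inverting y and h exchanges the first two parameters of P_VI up to sign, which exchanges n² and
m², and fixes the other two. -/
theorem IsPVI.dual [CharZero F] {D : Derivation k F F} {y r n m μ lam h : F}
    (hS : IsSetting D y r n m μ lam) (h0 : h ≠ 0) (h1 : h ≠ 1) (hy : h ≠ y)
    (hP : IsPVI D y n m μ lam h) : IsPVI (D.invVar y) y⁻¹ m n μ lam h⁻¹ := by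
  have e1 : h - 1 ≠ 0 := sub_ne_zero.2 h1
  have ey : h - y ≠ 0 := sub_ne_zero.2 hy
  have ey' : y - h ≠ 0 := sub_ne_zero.2 hy.symm
  have y0 := hS.y_ne_zero
  have y1 : y - 1 ≠ 0 := sub_ne_zero.2 hS.y_ne_one
  simp only [IsPVI] at *
  have hd : D.invVar y h⁻¹ = y ^ 2 * D h / h ^ 2 := by
    rw [Derivation.invVar_apply, D.map_inv]; ring
  rw [hd, Derivation.invVar_apply, D.map_div _ _ (pow_ne_zero 2 h0)]
  simp only [Derivation.leibniz, Derivation.leibniz_pow, smul_eq_mul, nsmul_eq_mul, hS.deriv_y]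
  rw [hP]
  simp only [pviRhs]
  generalize D h = p
  rw [show h⁻¹ - y⁻¹ = -(h - y) / (y * h) by field_simp; ring,
    show h⁻¹ - 1 = -(h - 1) / h by field_simp; ring,
    show y⁻¹ - 1 = -(y - 1) / y by field_simp; ring]
  push_cast
  field_simp
  ring

theorem isPVI_neg_left {D : Derivation k F F} {y n m μ lam h : F} :
    IsPVI D y (-n) m μ lam h ↔ IsPVI D y n m μ lam h := by
  simp [IsPVI]

theorem isPVI_neg_right {D : Derivation k F F} {y n m μ lam h : F} :
    IsPVI D y n (-m) μ lam h ↔ IsPVI D y n m μ lam h := by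
  simp [IsPVI]

theorem shiftSnd_neg_left (n m μ lam y r h p s : F) :
    shiftSnd (-n) m μ lam y r h p s = shiftSnd n m μ lam y r h p s := by
  simp [shiftSnd, shiftFst, quadQ]

theorem shiftFst_neg_right (n m μ lam y r h p s : F) :
    shiftFst n (-m) μ lam y r h p s = shiftFst n m μ lam y r h p s := by
  simp [shiftFst, quadQ]

/-- The squares with h' cancel, and the two polynomials `quadQ` differ by a multiple of h (h - 1),
because their values at 0 and at 1 do not depend on q. -/
theorem shiftFst_sub_shiftFst_neg [CharZero F] {D : Derivation k F F} {y r n m μ lam s h p : F}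
    (hS : IsSetting D y r n m μ lam) (hp : IsPair D y μ s h) :
    (shiftFst n m μ lam y r h p s - shiftFst (-n) m μ lam y r h p s) * s * (2 * μ * r) =
      n * (h - y) := by
  have h0 := hp.h_ne_zero
  have e1 : h - 1 ≠ 0 := sub_ne_zero.2 hp.h_ne_one
  have ey : h - y ≠ 0 := sub_ne_zero.2 hp.h_ne_y
  have s0 := hp.s_ne_zero
  have r0 := hS.r_ne_zero
  have μ0 := hS.μ_ne_zero
  have ν0 := hS.ν_ne_zero
  simp only [shiftFst, quadQ]
  rw [← sub_div, mul_assoc, div_mul_eq_mul_div, div_eq_iff (by simp [*])]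
  ring

/-- The invariant surface condition. -/
theorem shift_invariance [CharZero F] {D : Derivation k F F} {y r n m μ lam s h p : F}
    (hS : IsSetting D y r n m μ lam) (hp : IsPair D y μ s h) :
    (shiftFst n m μ lam y r h p s - shiftFst (-n) m μ lam y r h p s) * (y * D s + μ * s) =
      -n * r := by
  have key := shiftFst_sub_shiftFst_neg (p := p) hS hp
  have ey : y - h ≠ 0 := sub_ne_zero.2 hp.h_ne_y.symm
  have s0 := hp.s_ne_zero
  have r0 := hS.r_ne_zero
  have y0 := hS.y_ne_zero
  have hs : D s = s * (μ / y * ((y + h) / (y - h))) := by rw [← hp.quadrature]; field_simp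
  have : y * D s + μ * s = 2 * μ * s * r ^ 2 / (y - h) := by
    rw [hs, hS.sq_r]; field_simp; ring
  rw [this, ← mul_div_assoc, div_eq_iff ey]
  linear_combination r * key

theorem shiftSnd_eq {y r h : F} (n m μ lam p s : F) (hy : y ≠ 0)
    (hr : r ^ 2 = y) (h0 : h ≠ 0) :
    shiftSnd n m μ lam y r h p s =
      ((y * (y - 1) * p + (2 * μ - 1) * y * (h - 1)) ^ 2 - (h - y) ^ 2 *
        (n ^ 2 * h ^ 2 - (n ^ 2 + (m - 2 * μ + 1) ^ 2 - 2 * lam) * h + (m - 2 * μ + 1) ^ 2)) /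
      (8 * μ * (2 * μ - 1) * r * (h - y) * (h - 1) * h * s) := by
  have r0 : r ≠ 0 := by
    rintro rfl
    exact hy (by rw [← hr]; simp)
  have hc : y ^ 2 * h ^ 4 ≠ 0 := by simp [hy, h0]
  rw [shiftSnd, shiftFst, quadQ]
  refine Eq.trans ?_ (div_div_div_cancel_right₀ hc _ _)
  congr 1
  · field_simp
    ring
  · rw [← hr]
    field_simp
    ring

/-- The terms quadratic in h' cancel in the difference of the two shifts, so the diagonal difference
is linear in the momentum: it is governed by Y + m. -/
theorem shiftFst_sub_shiftSnd [CharZero F] {D : Derivation k F F} {y r n m μ lam s h p : F}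
    (hS : IsSetting D y r n m μ lam) (hp : IsPair D y μ s h) :
    (shiftFst n m μ lam y r h p s - shiftSnd n m μ lam y r h p s) * s * (4 * μ * r * h) =
      (h - y) * (momX μ y h p + (n - 2 * μ + 1) * h + m) := by
  have h0 := hp.h_ne_zero
  have y0 := hS.y_ne_zero
  have e1 : h - 1 ≠ 0 := sub_ne_zero.2 hp.h_ne_one
  have ey : h - y ≠ 0 := sub_ne_zero.2 hp.h_ne_y
  have s0 := hp.s_ne_zero
  have r0 := hS.r_ne_zero
  have μ0 := hS.μ_ne_zero
  have ν0 := hS.ν_ne_zero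
  rw [shiftSnd_eq _ _ _ _ _ _ y0 hS.sq_r h0]
  simp only [shiftFst, quadQ]
  rw [← sub_div, mul_assoc, div_mul_eq_mul_div, div_eq_iff (by simp [*])]
  simp only [momX]
  field_simp
  ring

/-- The lattice equation. -/
theorem shift_latticeEquation [CharZero F] {D : Derivation k F F} {y r n m μ lam s h t g : F}
    (hS : IsSetting D y r n m μ lam) (hp : IsPair D y μ s h) (hP : IsPVI D y n m μ lam h)
    (ht : t = shiftFst n m μ lam y r h (D h) s) (hp' : IsPair D y (1 / 2 - μ) t g) :
    (s - shiftSnd (n + 1) m (1 / 2 - μ) lam y r g (D g) t) *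
      (t - shiftSnd n m μ lam y r h (D h) s) * r = y - 1 := by
  obtain ⟨hX, -, hs⟩ := shift_site hS hp hP ht hp'
  have hrel := (quadrature_iff hS hp hP ht hp'.s_ne_zero hp'.h_ne_y).1 hp'.quadrature
  have d1 := shiftFst_sub_shiftSnd (p := D h) hS hp
  have d2 := shiftFst_sub_shiftSnd (p := D g) hS.neg_succ hp'
  -- Seen from the site of g with n + 1 reversed, the first shift leads back to s, while the second
  -- does not notice the sign.
  rw [← hs, shiftSnd_neg_left, hX] at d2
  rw [← ht] at d1
  have h0 := hp.h_ne_zero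
  have g0 := hp'.h_ne_zero
  have y0 := hS.y_ne_zero
  have e1 : h - 1 ≠ 0 := sub_ne_zero.2 hp.h_ne_one
  have ey : h - y ≠ 0 := sub_ne_zero.2 hp.h_ne_y
  have s0 := hp.s_ne_zero
  have t0 := hp'.s_ne_zero
  have r0 := hS.r_ne_zero
  have μ0 := hS.μ_ne_zero
  have ν0 := hS.ν_ne_zero
  have hZ : prodZ (n - 2 * μ + 1) m lam y h (momX μ y h (D h)) * (h * (h - 1)) =
      (h - y) * (momX μ y h (D h) ^ 2 - quadQ (n - 2 * μ + 1) m lam h) := by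
    simp only [prodZ]; field_simp
  rw [shiftFst_eq _ _ _ _ _ _ _ _ _ hp.h_ne_zero hp.h_ne_one hp.h_ne_y,
    eq_div_iff (by simp [μ0, ν0, r0, s0])] at ht
  generalize prodZ (n - 2 * μ + 1) m lam y h (momX μ y h (D h)) = Z at *
  generalize momX μ y h (D h) = X at *
  generalize s - shiftSnd (n + 1) m (1 / 2 - μ) lam y r g (D g) t = a at *
  generalize t - shiftSnd n m μ lam y r h (D h) s = b at *
  have hc : s * t * (4 * μ * r * h) * (4 * (1 / 2 - μ) * r * g) ≠ 0 := by
    have four : (4 : F) ≠ 0 := by norm_num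
    exact mul_ne_zero (mul_ne_zero (mul_ne_zero s0 t0) (by simp [μ0, r0, h0]))
      (mul_ne_zero (mul_ne_zero (mul_ne_zero four hS.neg_succ.μ_ne_zero) r0) g0)
  refine mul_left_cancel₀ hc ?_
  -- The two diagonals multiply to (h - y)(g - y)(m² - Y²). Vieta's formula at y evaluates the first
  -- two factors and at 0 the last, and Z cancels.
  have d3 : s * t * (4 * μ * r * h) * (4 * (1 / 2 - μ) * r * g) * (a * b * r) =
    ((h - y) * (X + (n - 2 * μ + 1) * h + m)) * ((g - y) * ((n - 2 * μ + 1) * g - X -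
      (n - 2 * μ + 1) * h + (-(n + 1) - 2 * (1 / 2 - μ) + 1) * g + m)) * r := by
    rw [← d1, ← d2]; ring
  rw [d3]
  simp only [linW, quadQ] at *
  linear_combination h * g * (y - 1) * r * ht + (g - y) * r * hZ + h * r * hrel

end Algebraic

/-! ### Generic solutions: algebraic independence -/

section Algebraic

variable {k F : Type*} [Field k] [Field F] [Algebra k F]

theorem isAlgebraic_adjoin_of_mem {s : Set F} {a : F} (ha : a ∈ IntermediateField.adjoin k s) :
    IsAlgebraic (Algebra.adjoin k s) a := by
  induction ha using IntermediateField.adjoin_induction with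
  | mem x hx =>
    exact isAlgebraic_algebraMap (⟨x, Algebra.subset_adjoin hx⟩ : Algebra.adjoin k s)
  | algebraMap x =>
    exact isAlgebraic_algebraMap (algebraMap k (Algebra.adjoin k s) x)
  | add x y _ _ hx hy => exact hx.add hy
  | inv x _ hx => exact hx.inv
  | mul x y _ _ hx hy => exact hx.mul hy

/-- A finite family that generates an algebraically independent family of the same size is
algebraically independent. -/
theorem AlgebraicIndependent.of_mem_adjoin {ι : Type*} [Finite ι] {x x' : ι → F}
    (hx : AlgebraicIndependent k x)
    (h : ∀ i, x i ∈ IntermediateField.adjoin k (Set.range x')) :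
    AlgebraicIndependent k x' := by
  have hI : (AlgebraicIndependent.matroid k F).Indep (Set.range x) :=
    AlgebraicIndependent.matroid_indep_iff.2 hx.to_subtype_range
  -- The rank in the algebraic independence matroid is monotone: x lies in the closure of the range
  -- of x', so x' has full rank, which forces both independence and injectivity.
  have hle : (Set.range x).encard ≤ (AlgebraicIndependent.matroid k F).eRk (Set.range x') := by
    rw [← hI.eRk_eq_encard, ← Matroid.eRk_closure_eq _ (Set.range x')]
    refine Matroid.eRk_mono _ ?_
    rintro _ ⟨i, rfl⟩
    rw [AlgebraicIndependent.matroid_closure_eq]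
    exact isAlgebraic_adjoin_of_mem (h i)
  have hcard : (Set.range x).encard = ENat.card ι := by
    rw [← Set.image_univ, hx.injective.encard_image, Set.encard_univ]
  have hcard' : (Set.range x').encard ≤ ENat.card ι := by
    rw [← Set.image_univ, ← Set.encard_univ]
    exact Set.encard_image_le _ _
  have hE := Matroid.eRk_le_encard (AlgebraicIndependent.matroid k F) (Set.range x')
  have hJ : (AlgebraicIndependent.matroid k F).Indep (Set.range x') := by
    rw [Matroid.indep_iff_eRk_eq_encard_of_finite (Set.finite_range x')]
    exact le_antisymm hE (hcard'.trans (hcard ▸ hle))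
  have hinj : Function.Injective x' := by
    rw [← Set.injOn_univ]
    refine Set.finite_univ.injOn_of_encard_image_eq ?_
    rw [Set.image_univ, Set.encard_univ]
    exact le_antisymm hcard' (hcard ▸ hle.trans hE)
  exact (algebraicIndependent_subtype_range hinj).1 (AlgebraicIndependent.matroid_indep_iff.1 hJ)

/-- Algebraic independence of `y`, `h` and `D h`. -/
def IsGen (D : Derivation k F F) (y h : F) : Prop := AlgebraicIndependent k ![y, h, D h]

theorem AlgebraicIndependent.of_mem_adjoin₃ {a b c a' b' c' : F}
    (hx : AlgebraicIndependent k ![a, b, c])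
    (h : ∀ E : IntermediateField k F, a' ∈ E → b' ∈ E → c' ∈ E → a ∈ E ∧ b ∈ E ∧ c ∈ E) :
    AlgebraicIndependent k ![a', b', c'] := by
  refine hx.of_mem_adjoin fun i => ?_
  have hs := IntermediateField.subset_adjoin k (Set.range ![a', b', c'])
  obtain ⟨h1, h2, h3⟩ := h (IntermediateField.adjoin k (Set.range ![a', b', c']))
    (hs ⟨0, rfl⟩) (hs ⟨1, rfl⟩) (hs ⟨2, rfl⟩)
  fin_cases i <;> assumption

theorem IsGen.dual {D : Derivation k F F} {y h : F} (hy : y ≠ 0) (h0 : h ≠ 0) (hg : IsGen D y h) :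
    IsGen (D.invVar y) y⁻¹ h⁻¹ := by
  refine AlgebraicIndependent.of_mem_adjoin₃ hg fun E h1 h2 h3 => ?_
  have h1' : y ∈ E := inv_inv y ▸ inv_mem h1
  have h2' : h ∈ E := inv_inv h ▸ inv_mem h2
  refine ⟨h1', h2', ?_⟩
  rw [Derivation.invVar_apply, D.map_inv] at h3
  have : D h = -y ^ 2 * (-D h / h ^ 2) * h ^ 2 / y ^ 2 := by field_simp
  rw [this]
  exact div_mem (mul_mem h3 (pow_mem h2' 2)) (pow_mem h1' 2)

theorem AlgebraicIndependent.aeval_ne_zero {x : Fin 3 → F} (hx : AlgebraicIndependent k x)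
    (P : MvPolynomial (Fin 3) k) (v : Fin 3 → k) (hv : MvPolynomial.eval v P ≠ 0) :
    MvPolynomial.aeval x P ≠ 0 := by
  intro h
  rw [hx.eq_zero_of_aeval_eq_zero P h] at hv
  simp at hv

/-- Supplies the test points at which the polynomials in `exists_shiftFst` are evaluated to see that
they are not zero. -/
theorem exists_sq_sub_ne [CharZero k] (a b : k) : ∃ x : k, (x - a) ^ 2 ≠ b := by
  by_cases h : b = 0
  · exact ⟨a + 1, by simp [h]⟩
  · exact ⟨a, by simpa using Ne.symm h⟩

/-- A generic solution can be shifted, and its shift is generic. -/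
theorem exists_shiftFst [CharZero k] [CharZero F] {D : Derivation k F F} {y r s h : F}
    {n m μ lam : k} (hS : IsSetting D y r (algebraMap k F n) (algebraMap k F m) (algebraMap k F μ)
      (algebraMap k F lam))
    (hp : IsPair D y (algebraMap k F μ) s h)
    (hP : IsPVI D y (algebraMap k F n) (algebraMap k F m) (algebraMap k F μ) (algebraMap k F lam) h)
    (hgen : IsGen D y h) :
    ∃ g, IsPair D y (1 / 2 - algebraMap k F μ) (shiftFst (algebraMap k F n) (algebraMap k F m)
      (algebraMap k F μ) (algebraMap k F lam) y r h (D h) s) g ∧ IsGen D y g := by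
  obtain ⟨q, hq⟩ : ∃ q : k, q = n - 2 * μ + 1 := ⟨_, rfl⟩
  have h2 : algebraMap k F 2 = 2 := map_ofNat _ 2
  have hq' : algebraMap k F n - 2 * algebraMap k F μ + 1 = algebraMap k F q := by
    simp [hq, h2]
  have h0 := hp.h_ne_zero
  have y0 := hS.y_ne_zero
  have y1 : y - 1 ≠ 0 := sub_ne_zero.2 hS.y_ne_one
  have e1 : h - 1 ≠ 0 := sub_ne_zero.2 hp.h_ne_one
  have ey : h - y ≠ 0 := sub_ne_zero.2 hp.h_ne_y
  have s0 := hp.s_ne_zero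
  have r0 := hS.r_ne_zero
  have μ0 := hS.μ_ne_zero
  have ν0 := hS.ν_ne_zero
  obtain ⟨X, hX⟩ : ∃ X, X = momX (algebraMap k F μ) y h (D h) := ⟨_, rfl⟩
  have hDh := deriv_eq_momX D (μ := algebraMap k F μ) hp.h_ne_y
  rw [← hX] at hDh
  have hDh' := eq_div_of_mul_eq (mul_ne_zero y0 y1) ((mul_comm _ _).trans hDh)
  have hX' : AlgebraicIndependent k ![y, h, X] := by
    refine AlgebraicIndependent.of_mem_adjoin₃ hgen fun E h1 h2 h3 => ⟨h1, h2, ?_⟩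
    have := E.algebraMap_mem μ
    rw [hDh']
    repeat' first
      | assumption | apply div_mem | apply sub_mem | apply mul_mem | apply one_mem | apply ofNat_mem
  -- The four expressions are polynomials in y, h, X; each is tested at (1, 0, x). Their
  -- nonvanishing means in turn Z ≠ 0, Z + W ≠ 0, g ≠ 0 and g ≠ 1.
  obtain ⟨x₁, hx₁⟩ := exists_sq_sub_ne 0 (m ^ 2)
  obtain ⟨x₂, hx₂⟩ := exists_sq_sub_ne q (2 * lam)
  rw [sub_zero] at hx₁
  have hx₁' : x₁ ^ 2 - m ^ 2 ≠ 0 := sub_ne_zero.2 hx₁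
  have hN : X ^ 2 - quadQ (algebraMap k F q) (algebraMap k F m) (algebraMap k F lam) h ≠ 0 := by
    have := hX'.aeval_ne_zero (.X 2 ^ 2 - (.C (q ^ 2) * .X 1 ^ 2 - .C (m ^ 2 + q ^ 2 - 2 * lam) * .X 1
      + .C (m ^ 2))) ![1, 0, x₁] (by simpa using hx₁')
    simpa [quadQ, h2] using this
  have hA : (h - y) * (X ^ 2 - quadQ (algebraMap k F q) (algebraMap k F m) (algebraMap k F lam) h)
      + h * (h - 1) * linW (algebraMap k F q) (algebraMap k F m) (algebraMap k F lam) h X ≠ 0 := by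
    have := hX'.aeval_ne_zero ((.X 1 - .X 0) * (.X 2 ^ 2 - (.C (q ^ 2) * .X 1 ^ 2
      - .C (m ^ 2 + q ^ 2 - 2 * lam) * .X 1 + .C (m ^ 2))) + .X 1 * (.X 1 - 1) *
      (.C (2 * q) * (.X 2 + .C q * .X 1) - .C (m ^ 2 + q ^ 2 - 2 * lam))) ![1, 0, x₁]
      (by simpa [sub_eq_zero] using hx₁.symm)
    simpa [quadQ, linW, h2] using this
  have hC : (X + algebraMap k F q * h) ^ 2 - algebraMap k F m ^ 2 ≠ 0 := by
    have := hX'.aeval_ne_zero ((.X 2 + .C q * .X 1) ^ 2 - .C (m ^ 2)) ![1, 0, x₁]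
      (by simpa using hx₁')
    simpa using this
  have hB : (X + algebraMap k F q * h - algebraMap k F q) ^ 2 - 2 * algebraMap k F lam ≠ 0 := by
    have := hX'.aeval_ne_zero ((.X 2 + .C q * .X 1 - .C q) ^ 2 - .C (2 * lam)) ![1, 0, x₂]
      (by simpa [sub_eq_zero] using hx₂)
    simpa [h2] using this
  clear hx₁ hx₁' hx₂
  generalize hZd : prodZ (algebraMap k F q) (algebraMap k F m) (algebraMap k F lam) y h X = Z
  have hZ : Z * (h * (h - 1)) =
      (h - y) * (X ^ 2 - quadQ (algebraMap k F q) (algebraMap k F m) (algebraMap k F lam) h) := by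
    rw [← hZd, prodZ]; field_simp
  rw [← hZ] at hA
  have hZ0 : Z ≠ 0 := by
    rintro rfl
    rw [zero_mul] at hZ
    exact mul_ne_zero ey hN hZ.symm
  generalize hWd : linW (algebraMap k F q) (algebraMap k F m) (algebraMap k F lam) h X = W at hA
  have hA0 : Z + W ≠ 0 := fun h' => hA (by linear_combination h * (h - 1) * h')
  -- The second root, as forced by Vieta's formula at y.
  obtain ⟨g, hg⟩ : ∃ g, g = y + Z * (y * (y - 1)) / ((h - y) * (Z + W)) := ⟨_, rfl⟩
  have hrel : Z * (y * (y - 1)) = (h - y) * (g - y) * (Z + W) := by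
    rw [hg]; field_simp; ring
  have gy : g ≠ y := by
    rintro rfl
    exact mul_ne_zero hZ0 (mul_ne_zero y0 y1) (by rw [hrel]; ring)
  -- The quadratic polynomial takes the value y (Y² - m²) at 0 and, for the next claim, (y - 1)((Y -
  -- q)² - 2λ) at 1.
  have g0 : g ≠ 0 := by
    rintro rfl
    refine mul_ne_zero (mul_ne_zero ey hC) y0 ?_
    simp only [← hWd, quadQ, linW] at hZ hrel
    linear_combination -y * hZ + h * hrel
  have g1 : g ≠ 1 := by
    rintro rfl
    refine mul_ne_zero (mul_ne_zero ey hB) y1 ?_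
    simp only [← hWd, quadQ, linW] at hZ hrel
    linear_combination -(y - 1) * hZ + (h - 1) * hrel
  have ht := shiftFst_eq (algebraMap k F n) (algebraMap k F m) (algebraMap k F μ)
    (algebraMap k F lam) y r h (D h) s hp.h_ne_zero hp.h_ne_one hp.h_ne_y
  rw [← hX, hq', hZd] at ht
  have ht0 : Z / (8 * algebraMap k F μ * (2 * algebraMap k F μ - 1) * r * s) ≠ 0 :=
    div_ne_zero hZ0 (mul_ne_zero (mul_ne_zero (mul_ne_zero (mul_ne_zero (by norm_num) μ0) ν0) r0)
      s0)
  rw [← ht] at ht0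
  have hp' : IsPair D y (1 / 2 - algebraMap k F μ) (shiftFst (algebraMap k F n) (algebraMap k F m)
      (algebraMap k F μ) (algebraMap k F lam) y r h (D h) s) g :=
    ⟨ht0, g0, g1, gy, (quadrature_iff hS hp hP rfl ht0 gy).2 (by
      rw [hq', ← hX, hZd, hWd]; exact hrel)⟩
  refine ⟨g, hp', ?_⟩
  obtain ⟨hX1, -, -⟩ := shift_site hS hp hP rfl hp'
  have hZ1 := prodZ_neg hp.h_ne_zero hp.h_ne_one hp.h_ne_y g0 g1 gy (hZd ▸ hWd ▸ hrel)
  rw [hq', ← hX] at hX1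
  rw [← hX1, hZd] at hZ1
  have eg : g - y ≠ 0 := sub_ne_zero.2 gy
  -- A field with y, g, g' contains the new momentum, hence Z, Y and W by invariance; then h, as the
  -- root paired with g, and finally X and h'.
  refine AlgebraicIndependent.of_mem_adjoin₃ hgen fun E hE1 hE2 hE3 => ?_
  have hEμ := E.algebraMap_mem μ
  have hEq := E.algebraMap_mem q
  have hEm := E.algebraMap_mem m
  have hEl := E.algebraMap_mem lam
  have hEX1 : momX (1 / 2 - algebraMap k F μ) y g (D g) ∈ E := by
    rw [momX]
    repeat' first
      | assumption | apply div_mem | apply sub_mem | apply mul_mem | apply one_mem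
      | apply ofNat_mem | apply add_mem
  have hEZ : Z ∈ E := by
    rw [← hZ1, prodZ, quadQ]
    repeat' first
      | assumption | apply div_mem | apply sub_mem | apply mul_mem | apply one_mem
      | apply ofNat_mem | apply add_mem | apply pow_mem | apply neg_mem
  have hY : X + algebraMap k F q * h =
      algebraMap k F q * g - momX (1 / 2 - algebraMap k F μ) y g (D g) := by rw [hX1]; ring
  have hEW : W ∈ E := by
    rw [← hWd, linW, hY]
    repeat' first
      | assumption | apply sub_mem | apply mul_mem | apply ofNat_mem | apply add_mem
      | apply pow_mem
  have hEh : h ∈ E := by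
    rw [show h = y + Z * (y * (y - 1)) / ((g - y) * (Z + W)) by rw [hrel]; field_simp; ring]
    repeat' first
      | assumption | apply div_mem | apply sub_mem | apply mul_mem | apply one_mem | apply add_mem
  have hEX : X ∈ E := by
    rw [eq_sub_of_add_eq hY]
    repeat' first | assumption | apply sub_mem | apply mul_mem
  refine ⟨hE1, hEh, ?_⟩
  rw [hDh']
  repeat' first
    | assumption | apply div_mem | apply sub_mem | apply mul_mem | apply one_mem | apply ofNat_mem

end Algebraic

/-! ### Sites, shifts and squares on the integer lattice -/

section Lattice

variable {k F : Type*} [Field k] [Field F] [Algebra k F]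

/-- The exponent `(1 + 2 (-1)^(n+m) τ) / 4`. -/
def latticeExp (τ : k) (n m : ℤ) : k := (1 + 2 * (-1) ^ (n + m) * τ) / 4

theorem latticeExp_comm (τ : k) (n m : ℤ) : latticeExp τ n m = latticeExp τ m n := by
  rw [latticeExp, latticeExp, add_comm n m]

theorem latticeExp_neg (τ : k) (n m : ℤ) : latticeExp τ (-n) m = latticeExp τ n m := by
  rw [latticeExp, latticeExp, zpow_add₀ (by simp), zpow_add₀ (by simp), zpow_neg, ← inv_zpow]
  simp

/-- The data of the differential field that do not depend on the lattice site. -/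
structure IsBase (D : Derivation k F F) (y r : F) (τ : k) : Prop where
  deriv_y : D y = 1
  y_ne_zero : y ≠ 0
  y_ne_one : y ≠ 1
  sq_r : r ^ 2 = y
  pos_ne_zero : 1 + 2 * τ ≠ 0
  neg_ne_zero : 1 - 2 * τ ≠ 0

/-- A solution at the lattice site `(n, m)` in a differential field. -/
structure IsLatticeSite (D : Derivation k F F) (y : F) (τ lam : k) (n m : ℤ) (s h : F) :
    Prop where
  pair : IsPair D y (algebraMap k F (latticeExp τ n m)) s h
  pvi : IsPVI D y n m (algebraMap k F (latticeExp τ n m)) (algebraMap k F lam) h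

/-- The first shift relation in a differential field. -/
def IsFstShift (D : Derivation k F F) (y r : F) (τ lam : k) (n m : ℤ) (s h t : F) : Prop :=
  t = shiftFst (n : F) m (algebraMap k F (latticeExp τ n m)) (algebraMap k F lam) y r h (D h) s

/-- The second shift relation in a differential field. -/
def IsSndShift (D : Derivation k F F) (y r : F) (τ lam : k) (n m : ℤ) (s h t : F) : Prop :=
  t = shiftSnd (n : F) m (algebraMap k F (latticeExp τ n m)) (algebraMap k F lam) y r h (D h) s

variable {D : Derivation k F F} {y r : F} {τ lam : k} {n m : ℤ} {s h t g : F}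

theorem IsGen.of_dual (hB : IsBase D y r τ) (h0 : h ≠ 0) (hg : IsGen (D.invVar y) y⁻¹ h) :
    IsGen D y h⁻¹ := by
  have := hg.dual (inv_ne_zero hB.y_ne_zero) h0
  rwa [D.invVar_invVar hB.y_ne_zero, inv_inv] at this

theorem isSndShift_iff :
    IsSndShift D y r τ lam n m s h t ↔ IsFstShift (D.invVar y) y⁻¹ r⁻¹ τ lam m n s h⁻¹ t := by
  rw [IsSndShift, IsFstShift, shiftSnd, latticeExp_comm, Derivation.invVar_apply, D.map_inv]
  rw [show -y ^ 2 * (-D h / h ^ 2) = y ^ 2 * D h / h ^ 2 by ring]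

theorem isFstShift_iff (hB : IsBase D y r τ) :
    IsFstShift D y r τ lam n m s h t ↔ IsSndShift (D.invVar y) y⁻¹ r⁻¹ τ lam m n s h⁻¹ t := by
  rw [isSndShift_iff, D.invVar_invVar hB.y_ne_zero]
  simp only [inv_inv]

theorem isLatticeSite_neg_left :
    IsLatticeSite D y τ lam (-n) m s h ↔ IsLatticeSite D y τ lam n m s h := by
  constructor <;> rintro ⟨h1, h2⟩
  · rw [latticeExp_neg] at h1 h2
    rw [Int.cast_neg, isPVI_neg_left] at h2
    exact ⟨h1, h2⟩
  · exact ⟨by rwa [latticeExp_neg], by rwa [latticeExp_neg, Int.cast_neg, isPVI_neg_left]⟩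

theorem isLatticeSite_neg_right :
    IsLatticeSite D y τ lam n (-m) s h ↔ IsLatticeSite D y τ lam n m s h := by
  have he : latticeExp τ n (-m) = latticeExp τ n m := by
    rw [latticeExp_comm, latticeExp_neg, latticeExp_comm]
  constructor <;> rintro ⟨h1, h2⟩
  · rw [he] at h1 h2
    rw [Int.cast_neg, isPVI_neg_right] at h2
    exact ⟨h1, h2⟩
  · exact ⟨by rwa [he], by rwa [he, Int.cast_neg, isPVI_neg_right]⟩

theorem isFstShift_neg_right :
    IsFstShift D y r τ lam n (-m) s h t ↔ IsFstShift D y r τ lam n m s h t := by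
  rw [IsFstShift, IsFstShift, latticeExp_comm, latticeExp_neg, latticeExp_comm, Int.cast_neg,
    shiftFst_neg_right]

variable [CharZero k] [CharZero F]

theorem latticeExp_succ (τ : k) (n m : ℤ) : latticeExp τ (n + 1) m = 1 / 2 - latticeExp τ n m := by
  rw [latticeExp, latticeExp, add_right_comm, zpow_add_one₀ (by simp)]
  ring

theorem latticeExp_ne_zero (hp : 1 + 2 * τ ≠ 0) (hm : 1 - 2 * τ ≠ 0) (n m : ℤ) :
    latticeExp τ n m ≠ 0 := by
  rw [latticeExp]
  rcases Int.even_or_odd (n + m) with h | h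
  · simpa [h.neg_one_zpow] using hp
  · rw [h.neg_one_zpow]
    intro h'
    apply hm
    linear_combination 4 * h'

theorem IsBase.setting (hB : IsBase D y r τ) (lam : k) (n m : ℤ) :
    IsSetting D y r (n : F) m (algebraMap k F (latticeExp τ n m)) (algebraMap k F lam) where
  deriv_y := hB.deriv_y
  y_ne_zero := hB.y_ne_zero
  y_ne_one := hB.y_ne_one
  sq_r := hB.sq_r
  deriv_n := D.map_intCast n
  deriv_m := D.map_intCast m
  deriv_μ := D.map_algebraMap _
  deriv_lam := D.map_algebraMap _
  μ_ne_zero := by simpa using latticeExp_ne_zero hB.pos_ne_zero hB.neg_ne_zero n m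
  -- 2μ - 1 is -2 times the exponent at the neighbouring site, so both nonvanishing conditions come
  -- from τ ≠ ±1/2.
  ν_ne_zero h := by
    have h1 := latticeExp_ne_zero hB.pos_ne_zero hB.neg_ne_zero (n + 1) m
    rw [latticeExp_succ] at h1
    have h2 : algebraMap k F (2 * latticeExp τ n m - 1) = 0 := by
      rw [map_sub, map_mul, map_ofNat, map_one, h]
    rw [map_eq_zero] at h2
    exact h1 (by linear_combination -h2 / 2)

theorem IsBase.dual (hB : IsBase D y r τ) : IsBase (D.invVar y) y⁻¹ r⁻¹ τ where
  deriv_y := (hB.setting 0 0 0).dual.deriv_y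
  y_ne_zero := inv_ne_zero hB.y_ne_zero
  y_ne_one := by simpa using hB.y_ne_one
  sq_r := by rw [inv_pow, hB.sq_r]
  pos_ne_zero := hB.pos_ne_zero
  neg_ne_zero := hB.neg_ne_zero

theorem IsLatticeSite.dual (hB : IsBase D y r τ) (hs : IsLatticeSite D y τ lam n m s h) :
    IsLatticeSite (D.invVar y) y⁻¹ τ lam m n s h⁻¹ := by
  have hp := hs.pair
  have hP := hs.pvi
  rw [latticeExp_comm] at hp hP
  have hS := hB.setting lam n m
  rw [latticeExp_comm] at hS
  exact ⟨hp.dual hB.y_ne_zero, hP.dual hS hp.h_ne_zero hp.h_ne_one hp.h_ne_y⟩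

theorem IsLatticeSite.of_dual (hB : IsBase D y r τ)
    (hs : IsLatticeSite (D.invVar y) y⁻¹ τ lam m n s h) : IsLatticeSite D y τ lam n m s h⁻¹ := by
  have := hs.dual hB.dual
  rwa [D.invVar_invVar hB.y_ne_zero, inv_inv] at this

/-- Shifting in `n` preserves solutions, and the shift is reversible. -/
theorem IsLatticeSite.shiftFst (hB : IsBase D y r τ) (hs : IsLatticeSite D y τ lam n m s h)
    (ht : IsFstShift D y r τ lam n m s h t)
    (hp : IsPair D y (algebraMap k F (latticeExp τ (n + 1) m)) t g) :
    IsLatticeSite D y τ lam (n + 1) m t g ∧ IsFstShift D y r τ lam (-(n + 1)) m t g s := by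
  have he : algebraMap k F (latticeExp τ (n + 1) m) =
      1 / 2 - algebraMap k F (latticeExp τ n m) := by
    rw [latticeExp_succ, map_sub, map_div₀, map_one, map_ofNat]
  have hp' := hp
  rw [he] at hp'
  obtain ⟨-, h1, h2⟩ := shift_site (hB.setting lam n m) hs.pair hs.pvi ht hp'
  refine ⟨⟨hp, ?_⟩, ?_⟩
  · rw [he]; exact_mod_cast h1
  · rw [IsFstShift, latticeExp_neg, he]; exact_mod_cast h2

/-- Shifting in `m` preserves solutions, and the shift is reversible. -/
theorem IsLatticeSite.shiftSnd (hB : IsBase D y r τ) (hs : IsLatticeSite D y τ lam n m s h)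
    (ht : IsSndShift D y r τ lam n m s h t)
    (hp : IsPair D y (algebraMap k F (latticeExp τ n (m + 1))) t g) :
    IsLatticeSite D y τ lam n (m + 1) t g ∧ IsSndShift D y r τ lam n (-(m + 1)) t g s := by
  rw [latticeExp_comm] at hp
  obtain ⟨h1, h2⟩ := (hs.dual hB).shiftFst hB.dual (isSndShift_iff.1 ht) (hp.dual hB.y_ne_zero)
  exact ⟨by simpa using h1.of_dual hB, isSndShift_iff.2 h2⟩

theorem exists_isFstShift (hB : IsBase D y r τ) (hs : IsLatticeSite D y τ lam n m s h)
    (hg : IsGen D y h) : ∃ p : F × F, (IsLatticeSite D y τ lam (n + 1) m p.1 p.2 ∧ IsGen D y p.2) ∧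
      IsFstShift D y r τ lam n m s h p.1 := by
  have hS := hB.setting lam n m
  have hP := hs.pvi
  rw [← map_intCast (algebraMap k F) n, ← map_intCast (algebraMap k F) m] at hS hP
  obtain ⟨g, h1, h2⟩ := exists_shiftFst hS hs.pair hP hg
  refine ⟨(_, g), ⟨(hs.shiftFst hB (by rw [IsFstShift, ← map_intCast (algebraMap k F) n,
    ← map_intCast (algebraMap k F) m]) ?_).1, h2⟩, ?_⟩
  · rwa [latticeExp_succ, map_sub, map_div₀, map_one, map_ofNat]
  · rw [IsFstShift, ← map_intCast (algebraMap k F) n, ← map_intCast (algebraMap k F) m]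

/-- A solution at n is also one at -n. Its forward shift lands at -n + 1 = -(n - 1), and
reversibility reads this as a step from n - 1 to n. -/
theorem exists_isFstShift_pred (hB : IsBase D y r τ) (hs : IsLatticeSite D y τ lam n m s h)
    (hg : IsGen D y h) : ∃ p : F × F, (IsLatticeSite D y τ lam (n - 1) m p.1 p.2 ∧ IsGen D y p.2) ∧
      IsFstShift D y r τ lam (n - 1) m p.1 p.2 s := by
  have hs' := isLatticeSite_neg_left.2 hs
  obtain ⟨p, ⟨h1, h2⟩, h3⟩ := exists_isFstShift hB hs' hg
  have h4 := (hs'.shiftFst hB h3 h1.pair).2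
  rw [show -(-n + 1) = n - 1 by ring] at h4
  rw [show -n + 1 = -(n - 1) by ring, isLatticeSite_neg_left] at h1
  exact ⟨p, ⟨h1, h2⟩, h4⟩

theorem exists_isSndShift (hB : IsBase D y r τ) (hs : IsLatticeSite D y τ lam n m s h)
    (hg : IsGen D y h) : ∃ p : F × F, (IsLatticeSite D y τ lam n (m + 1) p.1 p.2 ∧ IsGen D y p.2) ∧
      IsSndShift D y r τ lam n m s h p.1 := by
  obtain ⟨p, ⟨h1, h2⟩, h3⟩ :=
    exists_isFstShift hB.dual (hs.dual hB) (hg.dual hB.y_ne_zero hs.pair.h_ne_zero)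
  exact ⟨(p.1, p.2⁻¹), ⟨h1.of_dual hB, h2.of_dual hB h1.pair.h_ne_zero⟩, isSndShift_iff.2 h3⟩

theorem exists_isSndShift_pred (hB : IsBase D y r τ) (hs : IsLatticeSite D y τ lam n m s h)
    (hg : IsGen D y h) : ∃ p : F × F, (IsLatticeSite D y τ lam n (m - 1) p.1 p.2 ∧ IsGen D y p.2) ∧
      IsSndShift D y r τ lam n (m - 1) p.1 p.2 s := by
  obtain ⟨p, ⟨h1, h2⟩, h3⟩ :=
    exists_isFstShift_pred hB.dual (hs.dual hB) (hg.dual hB.y_ne_zero hs.pair.h_ne_zero)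
  exact ⟨(p.1, p.2⁻¹), ⟨h1.of_dual hB, h2.of_dual hB h1.pair.h_ne_zero⟩,
    isSndShift_iff.2 (by simpa using h3)⟩

theorem IsLatticeSite.latticeEquation {s₁ h₁ s₂ s₃ : F} (hB : IsBase D y r τ)
    (hs : IsLatticeSite D y τ lam n m s h) (hs₁ : IsLatticeSite D y τ lam (n + 1) m s₁ h₁)
    (h01 : IsFstShift D y r τ lam n m s h s₁) (h02 : IsSndShift D y r τ lam n m s h s₂)
    (h13 : IsSndShift D y r τ lam (n + 1) m s₁ h₁ s₃) :
    (s - s₃) * (s₁ - s₂) * r = y - 1 := by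
  have hp := hs₁.pair
  have he : algebraMap k F (latticeExp τ (n + 1) m) =
      1 / 2 - algebraMap k F (latticeExp τ n m) := by
    rw [latticeExp_succ, map_sub, map_div₀, map_one, map_ofNat]
  rw [IsSndShift, he] at h13
  rw [he] at hp
  rw [h13, h02]
  exact_mod_cast shift_latticeEquation (hB.setting lam n m) hs.pair hs.pvi h01 hp

/-- The two shifts commute. -/
theorem IsLatticeSite.shift_comm {s₁ h₁ s₂ h₂ s₃ : F} (hB : IsBase D y r τ)
    (hs : IsLatticeSite D y τ lam n m s h) (hs₁ : IsLatticeSite D y τ lam (n + 1) m s₁ h₁)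
    (hs₂ : IsLatticeSite D y τ lam n (m + 1) s₂ h₂)
    (h01 : IsFstShift D y r τ lam n m s h s₁) (h02 : IsSndShift D y r τ lam n m s h s₂)
    (h13 : IsSndShift D y r τ lam (n + 1) m s₁ h₁ s₃) :
    IsFstShift D y r τ lam n (m + 1) s₂ h₂ s₃ := by
  have e1 := hs.latticeEquation hB hs₁ h01 h02 h13
  obtain ⟨t, ht⟩ : ∃ t, IsFstShift D y r τ lam n (m + 1) s₂ h₂ t := by
    simp only [IsFstShift, exists_eq]
  -- The dual lattice equation uses the path through (n, m + 1) and, as r² = y, takes the same form.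
  -- Both equations have the nonzero factor (s₁ - s₂) r, so they determine the same fourth corner.
  have e2 := (hs.dual hB).latticeEquation hB.dual (hs₂.dual hB) (isSndShift_iff.1 h02)
    ((isFstShift_iff hB).1 h01) ((isFstShift_iff hB).1 ht)
  have y0 := hB.y_ne_zero
  have r0 := (hB.setting 0 0 0).r_ne_zero
  have e3 : (s - t) * (s₁ - s₂) * r = y - 1 := by
    have : (s - t) * (s₂ - s₁) = (y⁻¹ - 1) * r := by rw [← e2]; field_simp
    calc (s - t) * (s₁ - s₂) * r = -((s - t) * (s₂ - s₁)) * r := by ring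
      _ = (1 - y⁻¹) * r ^ 2 := by rw [this]; ring
      _ = y - 1 := by rw [hB.sq_r]; field_simp
  have h0 : (s₁ - s₂) * r ≠ 0 := by
    intro h0
    rw [mul_assoc, h0, mul_zero] at e1
    exact hB.y_ne_one (sub_eq_zero.1 e1.symm)
  have : s₃ = t := by
    rw [← e3, mul_assoc, mul_assoc] at e1
    linear_combination -(mul_right_cancel₀ h0 e1)
  rw [this]
  exact ht

/-- Reflecting m to -m turns the downward square into an upward one: the shifts in m are reversed,
and the shift in n depends only on m². -/
theorem IsLatticeSite.shift_comm_pred {s₁ h₁ s₂ h₂ s₃ h₃ : F} (hB : IsBase D y r τ)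
    (hs : IsLatticeSite D y τ lam n m s h) (hs₁ : IsLatticeSite D y τ lam (n + 1) m s₁ h₁)
    (hs₂ : IsLatticeSite D y τ lam n (m - 1) s₂ h₂)
    (hs₃ : IsLatticeSite D y τ lam (n + 1) (m - 1) s₃ h₃)
    (h01 : IsFstShift D y r τ lam n m s h s₁) (h20 : IsSndShift D y r τ lam n (m - 1) s₂ h₂ s)
    (h31 : IsSndShift D y r τ lam (n + 1) (m - 1) s₃ h₃ s₁) :
    IsFstShift D y r τ lam n (m - 1) s₂ h₂ s₃ := by
  have h02 := (hs₂.shiftSnd hB h20 (by rw [sub_add_cancel]; exact hs.pair)).2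
  have h13 := (hs₃.shiftSnd hB h31 (by rw [sub_add_cancel]; exact hs₁.pair)).2
  rw [sub_add_cancel] at h02 h13
  rw [← isLatticeSite_neg_right] at hs hs₁ hs₂
  rw [← isFstShift_neg_right] at h01 ⊢
  rw [show -(m - 1) = -m + 1 by ring] at *
  exact hs.shift_comm hB hs₁ hs₂ h01 h02 h13

/-- By reversibility the predecessor s' is the shift of s with n replaced by -n, which is the
situation of `shift_invariance`. -/
theorem IsLatticeSite.invariance_fst {s' h' : F} (hB : IsBase D y r τ)
    (hs : IsLatticeSite D y τ lam n m s h) (hs' : IsLatticeSite D y τ lam (n - 1) m s' h')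
    (h1 : IsFstShift D y r τ lam n m s h t) (h2 : IsFstShift D y r τ lam (n - 1) m s' h' s) :
    (t - s') * (y * D s + algebraMap k F (latticeExp τ n m) * s) = -n * r := by
  have h3 := (hs'.shiftFst hB h2 (by rw [sub_add_cancel]; exact hs.pair)).2
  rw [sub_add_cancel, IsFstShift, latticeExp_neg, Int.cast_neg] at h3
  rw [h1, h3]
  exact shift_invariance (hB.setting lam n m) hs.pair

theorem IsLatticeSite.invariance_snd {s' h' : F} (hB : IsBase D y r τ)
    (hs : IsLatticeSite D y τ lam n m s h) (hs' : IsLatticeSite D y τ lam n (m - 1) s' h')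
    (h1 : IsSndShift D y r τ lam n m s h t) (h2 : IsSndShift D y r τ lam n (m - 1) s' h' s) :
    (t - s') * (y * D s - algebraMap k F (latticeExp τ n m) * s) * r = m := by
  have := (hs.dual hB).invariance_fst hB.dual (hs'.dual hB) (isSndShift_iff.1 h1)
    (isSndShift_iff.1 h2)
  have y0 := hB.y_ne_zero
  have r0 := (hB.setting 0 0 0).r_ne_zero
  rw [latticeExp_comm, Derivation.invVar_apply, show y⁻¹ * (-y ^ 2 * D s) = -(y * D s) by
    field_simp] at this
  calc _ = -((t - s') * (-(y * D s) + algebraMap k F (latticeExp τ n m) * s)) * r := by ring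
    _ = m := by rw [this]; field_simp

end Lattice

/-! ### Extension of one generic solution to the whole lattice -/

theorem exists_nat_chain {α : Type*} (A : ℕ → α → Prop) (R : ℕ → α → α → Prop)
    (up : ∀ n a, A n a → ∃ b, A (n + 1) b ∧ R n a b) (a₀ : α) (h₀ : A 0 a₀) :
    ∃ f : ℕ → α, f 0 = a₀ ∧ ∀ n, A n (f n) ∧ R n (f n) (f (n + 1)) := by
  choose! u hu using up
  refine ⟨fun n => Nat.rec a₀ u n, rfl, fun n => ?_⟩
  have hA : ∀ n, A n (Nat.rec (motive := fun _ => α) a₀ u n) := by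
    intro n
    induction n with
    | zero => exact h₀
    | succ n ih => exact (hu n _ ih).1
  exact ⟨hA n, (hu n _ (hA n)).2⟩

/-- A two-sided chain through a given point. -/
theorem exists_int_chain {α : Type*} (A : ℤ → α → Prop) (R : ℤ → α → α → Prop)
    (up : ∀ n a, A n a → ∃ b, A (n + 1) b ∧ R n a b)
    (down : ∀ n a, A n a → ∃ b, A (n - 1) b ∧ R (n - 1) b a) (n₀ : ℤ) (a₀ : α) (h₀ : A n₀ a₀) :
    ∃ f : ℤ → α, f n₀ = a₀ ∧ ∀ n, A n (f n) ∧ R n (f n) (f (n + 1)) := by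
  obtain ⟨u, hu0, hu⟩ := exists_nat_chain (fun k => A (n₀ + k)) (fun k => R (n₀ + k))
    (fun k a h => by simpa [add_assoc] using up _ a h) a₀ (by simpa using h₀)
  obtain ⟨v, hv0, hv⟩ := exists_nat_chain (fun k => A (n₀ - k)) (fun k a b => R (n₀ - (k + 1)) b a)
    (fun k a h => by simpa [sub_sub] using down _ a h) a₀ (by simpa using h₀)
  refine ⟨fun n => if n₀ ≤ n then u (n - n₀).toNat else v (n₀ - n).toNat, by simp [hu0],
    fun n => ?_⟩
  rcases le_or_gt n₀ n with h | h
  · obtain ⟨j, rfl⟩ := Int.le.dest h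
    have h1 : n₀ ≤ n₀ + j + 1 := by omega
    have h2 : (n₀ + j + 1 - n₀).toNat = j + 1 := by omega
    simpa [h1, h2] using hu j
  · obtain ⟨j, rfl⟩ : ∃ j : ℕ, n = n₀ - (j + 1) := ⟨(n₀ - n - 1).toNat, by omega⟩
    have h1 : ¬ n₀ ≤ n₀ - (j + 1) := by omega
    have h2 : (n₀ - (n₀ - ((j : ℤ) + 1))).toNat = j + 1 := by omega
    have hA := (hv (j + 1)).1
    have hR := (hv j).2
    push_cast at hA
    simp only [h1, if_false, h2]
    refine ⟨hA, ?_⟩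
    -- For j = 0 the right end of the step is n₀ itself, where the chain is read from u; u and v
    -- agree there.
    rcases j with _ | j
    · simpa [hu0, ← hv0] using hR
    · have h3 : ¬ n₀ ≤ n₀ - ((j + 1 : ℕ) + 1) + 1 := by push_cast; omega
      have h4 : (n₀ - (n₀ - (((j + 1 : ℕ) : ℤ) + 1) + 1)).toNat = j + 1 := by omega
      simp only [h3, if_false, h4]
      exact hR

section Lattice

variable {k F : Type*} [Field k] [CharZero k] [Field F] [CharZero F] [Algebra k F]
variable {D : Derivation k F F} {y r : F} {τ lam : k}

/-- A generic solution at one lattice site extends to the whole lattice. -/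
theorem exists_lattice_family (hB : IsBase D y r τ) (n₀ m₀ : ℤ) (s₀ h₀ : F)
    (hs : IsLatticeSite D y τ lam n₀ m₀ s₀ h₀) (hg : IsGen D y h₀) :
    ∃ S H : ℤ → ℤ → F, (∀ n m, IsLatticeSite D y τ lam n m (S n m) (H n m)) ∧
      (∀ n m, IsFstShift D y r τ lam n m (S n m) (H n m) (S (n + 1) m)) ∧
      (∀ n m, IsSndShift D y r τ lam n m (S n m) (H n m) (S n (m + 1))) ∧
      S n₀ m₀ = s₀ ∧ H n₀ m₀ = h₀ := by
  obtain ⟨f, hf0, hf⟩ := exists_int_chain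
    (fun n (p : F × F) => IsLatticeSite D y τ lam n m₀ p.1 p.2 ∧ IsGen D y p.2)
    (fun n p p' => IsFstShift D y r τ lam n m₀ p.1 p.2 p'.1)
    (fun n p hp => exists_isFstShift hB hp.1 hp.2)
    (fun n p hp => exists_isFstShift_pred hB hp.1 hp.2) n₀ (s₀, h₀) ⟨hs, hg⟩
  have hcol : ∀ n, ∃ c : ℤ → F × F, c m₀ = f n ∧
      ∀ m, (IsLatticeSite D y τ lam n m (c m).1 (c m).2 ∧ IsGen D y (c m).2) ∧
        IsSndShift D y r τ lam n m (c m).1 (c m).2 (c (m + 1)).1 := fun n =>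
    exists_int_chain
      (fun m (p : F × F) => IsLatticeSite D y τ lam n m p.1 p.2 ∧ IsGen D y p.2)
      (fun m p p' => IsSndShift D y r τ lam n m p.1 p.2 p'.1)
      (fun m p hp => exists_isSndShift hB hp.1 hp.2)
      (fun m p hp => exists_isSndShift_pred hB hp.1 hp.2) m₀ (f n) (hf n).1
  choose c hc0 hc using hcol
  have hsite : ∀ n m, IsLatticeSite D y τ lam n m (c n m).1 (c n m).2 := fun n m => (hc n m).1.1
  have hsnd : ∀ n m, IsSndShift D y r τ lam n m (c n m).1 (c n m).2 (c n (m + 1)).1 :=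
    fun n m => (hc n m).2
  refine ⟨fun n m => (c n m).1, fun n m => (c n m).2, hsite, fun n m => ?_, hsnd,
    by simp [hc0, hf0], by simp [hc0, hf0]⟩
  -- The columns were built independently from the row m₀, so only the shifts in m hold so far; the
  -- shifts in n spread from that row by commuting squares.
  induction m using Int.inductionOn' (b := m₀) with
  | zero => simpa only [hc0] using (hf n).2
  | succ m _ ih =>
    exact (hsite n m).shift_comm hB (hsite _ _) (hsite _ _) ih (hsnd _ _) (hsnd _ _)
  | pred m _ ih =>
    refine (hsite n m).shift_comm_pred hB (hsite _ _) (hsite _ _) (hsite _ _) ih ?_ ?_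
    · simpa using hsnd n (m - 1)
    · simpa using hsnd (n + 1) (m - 1)

end Lattice

/-! ### The differential field of meromorphic functions -/

noncomputable section

/-- The conditions on the domain `U`. -/
class IsDomainSet (U : Set ℂ) : Prop where
  isOpen : IsOpen U
  isPreconnected : IsPreconnected U
  nonempty : U.Nonempty

variable {U : Set ℂ}

theorem eventually_nhdsNE_of_codiscreteWithin (hU : IsOpen U) {x : ℂ} (hx : x ∈ U) {p : ℂ → Prop}
    (h : ∀ᶠ y in codiscreteWithin U, p y) : ∀ᶠ y in 𝓝[≠] x, p y := by
  have h1 := mem_codiscreteWithin_iff_forall_mem_nhdsNE.1 h x hx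
  filter_upwards [h1, nhdsWithin_le_nhds (hU.mem_nhds hx)] with y hy hyU
  exact hy.resolve_right fun h => h hyU

theorem eventually_codiscreteWithin_of_nhdsNE {p : ℂ → Prop}
    (h : ∀ x ∈ U, ∀ᶠ y in 𝓝[≠] x, p y) : ∀ᶠ y in codiscreteWithin U, p y :=
  mem_codiscreteWithin_iff_forall_mem_nhdsNE.2 fun x hx =>
    mem_of_superset (h x hx) Set.subset_union_left

instance [hU : IsDomainSet U] : (codiscreteWithin U).NeBot := by
  obtain ⟨x, hx⟩ := hU.nonempty
  by_contra h
  rw [not_neBot] at h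
  have : ∀ᶠ y in 𝓝[≠] x, False :=
    eventually_nhdsNE_of_codiscreteWithin hU.isOpen hx (by rw [h]; exact eventually_bot)
  exact NeBot.ne inferInstance (eventually_false_iff_eq_bot.1 this)

/-- A meromorphic function on a connected set vanishes identically or has discrete zeros. -/
theorem MeromorphicOn.eq_zero_or_ne_zero (hU : IsPreconnected U) {f : ℂ → ℂ}
    (hf : MeromorphicOn f U) :
    (∀ᶠ y in codiscreteWithin U, f y = 0) ∨ ∀ᶠ y in codiscreteWithin U, f y ≠ 0 := by
  by_cases h : ∃ x ∈ U, meromorphicOrderAt f x ≠ ⊤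
  · obtain ⟨x, hx, hfx⟩ := h
    exact .inr <| hf.eventually_codiscreteWithin_apply_ne_zero fun y hy =>
      hf.meromorphicOrderAt_ne_top_of_isPreconnected hU hx hy hfx
  · push Not at h
    exact .inl <| eventually_codiscreteWithin_of_nhdsNE fun x hx =>
      meromorphicOrderAt_eq_top_iff.1 (h x hx)

/-- The algebra of functions that are meromorphic on `U`. -/
def meroSubalgebra (U : Set ℂ) : Subalgebra ℂ (ℂ → ℂ) where
  carrier := {f | MeromorphicOn f U}
  mul_mem' hf hg := hf.mul hg
  add_mem' hf hg := hf.add hg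
  algebraMap_mem' c := MeromorphicOn.const c

/-- The ideal of functions that vanish off a discrete set. -/
def nullIdeal (U : Set ℂ) : Ideal (meroSubalgebra U) where
  carrier := {f | ∀ᶠ y in codiscreteWithin U, (f : ℂ → ℂ) y = 0}
  add_mem' {f g} hf hg := by
    change ∀ᶠ y in codiscreteWithin U, (f : ℂ → ℂ) y + (g : ℂ → ℂ) y = 0
    filter_upwards [hf, hg] with y h1 h2
    rw [h1, h2, add_zero]
  zero_mem' := by simp
  smul_mem' c f hf := by
    change ∀ᶠ y in codiscreteWithin U, (c : ℂ → ℂ) y * (f : ℂ → ℂ) y = 0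
    filter_upwards [hf] with y h1
    rw [h1, mul_zero]

/-- On a connected set a meromorphic function that is not null has discrete zeros, so its pointwise
inverse is an inverse modulo the ideal. -/
instance nullIdeal.isMaximal [hU : IsDomainSet U] : (nullIdeal U).IsMaximal := by
  rw [Ideal.isMaximal_iff]
  refine ⟨fun h => ?_, fun J x hJ hx hxJ => ?_⟩
  · have : ∀ᶠ y in codiscreteWithin U, ((1 : meroSubalgebra U) : ℂ → ℂ) y = 0 := h
    obtain ⟨y, hy⟩ := this.exists
    exact one_ne_zero hy
  · have hx' : MeromorphicOn (x : ℂ → ℂ) U := x.2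
    have h1 := (hx'.eq_zero_or_ne_zero hU.isPreconnected).resolve_left hx
    let z : meroSubalgebra U := ⟨(x : ℂ → ℂ)⁻¹, hx'.inv⟩
    have h2 : 1 - z * x ∈ nullIdeal U := by
      filter_upwards [h1] with y hy
      simp [z, hy]
    have := J.add_mem (hJ h2) (J.mul_mem_left z hxJ)
    simpa using this

/-- A model `F` of the field of meromorphic functions on `U` up to equality off a discrete set. -/
structure MeroModel (U : Set ℂ) (F : Type) [Field F] [Algebra ℂ F] where
  /-- The class of a meromorphic function. -/
  toField : meroSubalgebra U →ₐ[ℂ] F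
  surjective : Function.Surjective toField
  eq_zero_iff : ∀ f, toField f = 0 ↔ ∀ᶠ y in codiscreteWithin U, (f : ℂ → ℂ) y = 0

theorem exists_meroModel (U : Set ℂ) [IsDomainSet U] :
    ∃ (F : Type) (_ : Field F) (_ : Algebra ℂ F), Nonempty (MeroModel U F) :=
  letI : Field (meroSubalgebra U ⧸ nullIdeal U) := Ideal.Quotient.field _
  ⟨meroSubalgebra U ⧸ nullIdeal U, Ideal.Quotient.field _, Ideal.Quotient.algebra ℂ,
    ⟨⟨Ideal.Quotient.mkₐ ℂ (nullIdeal U), Ideal.Quotient.mk_surjective, fun _ =>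
      Ideal.Quotient.eq_zero_iff_mem⟩⟩⟩

namespace MeroModel

variable {F : Type} [Field F] [Algebra ℂ F] (M : MeroModel U F)

/-- The class of a meromorphic function. -/
def cls {f : ℂ → ℂ} (hf : MeromorphicOn f U) : F := M.toField ⟨f, hf⟩

/-- The function `f` represents the element `a`. -/
def Rep (a : F) (f : ℂ → ℂ) : Prop := ∃ hf : MeromorphicOn f U, M.cls hf = a

theorem exists_rep (a : F) : ∃ f, M.Rep a f := by
  obtain ⟨f, rfl⟩ := M.surjective a
  exact ⟨f, f.2, rfl⟩

theorem rep_mk {f : ℂ → ℂ} (hf : MeromorphicOn f U) : M.Rep (M.cls hf) f := ⟨hf, rfl⟩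

namespace Rep

variable {M : MeroModel U F} {a b : F} {f g : ℂ → ℂ}

theorem eq_iff (ha : M.Rep a f) (hb : M.Rep b g) :
    a = b ↔ ∀ᶠ y in codiscreteWithin U, f y = g y := by
  obtain ⟨hf, rfl⟩ := ha
  obtain ⟨hg, rfl⟩ := hb
  rw [← sub_eq_zero, cls, cls, ← map_sub, M.eq_zero_iff]
  simp [sub_eq_zero]

theorem congr (ha : M.Rep a f) (hg : MeromorphicOn g U)
    (h : ∀ᶠ y in codiscreteWithin U, f y = g y) : M.Rep a g :=
  ⟨hg, ((ha.eq_iff (M.rep_mk hg)).2 h).symm⟩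

theorem const (c : ℂ) : M.Rep (algebraMap ℂ F c) fun _ => c :=
  ⟨MeromorphicOn.const c, M.toField.commutes c⟩

theorem intCast (n : ℤ) : M.Rep (n : F) fun _ => n := by
  simpa using const (M := M) n

theorem one : M.Rep (1 : F) fun _ => 1 := by
  simpa using const (M := M) 1

theorem ofNat (n : ℕ) [n.AtLeastTwo] : M.Rep (OfNat.ofNat n : F) fun _ => OfNat.ofNat n := by
  simpa only [map_ofNat] using const (M := M) (OfNat.ofNat n)

theorem zero : M.Rep (0 : F) fun _ => 0 := by
  simpa using const (M := M) 0

theorem add (ha : M.Rep a f) (hb : M.Rep b g) : M.Rep (a + b) fun y => f y + g y := by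
  obtain ⟨hf, rfl⟩ := ha
  obtain ⟨hg, rfl⟩ := hb
  exact ⟨hf.add hg, map_add M.toField ⟨f, hf⟩ ⟨g, hg⟩⟩

theorem mul (ha : M.Rep a f) (hb : M.Rep b g) : M.Rep (a * b) fun y => f y * g y := by
  obtain ⟨hf, rfl⟩ := ha
  obtain ⟨hg, rfl⟩ := hb
  exact ⟨hf.mul hg, map_mul M.toField ⟨f, hf⟩ ⟨g, hg⟩⟩

theorem neg (ha : M.Rep a f) : M.Rep (-a) fun y => -f y := by
  obtain ⟨hf, rfl⟩ := ha
  exact ⟨hf.neg, map_neg M.toField ⟨f, hf⟩⟩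

theorem sub (ha : M.Rep a f) (hb : M.Rep b g) : M.Rep (a - b) fun y => f y - g y := by
  simpa only [sub_eq_add_neg] using ha.add hb.neg

theorem pow (ha : M.Rep a f) (n : ℕ) : M.Rep (a ^ n) fun y => f y ^ n := by
  obtain ⟨hf, rfl⟩ := ha
  exact ⟨hf.pow n, map_pow M.toField ⟨f, hf⟩ n⟩

variable [hU : IsDomainSet U]

theorem ne_zero_iff (ha : M.Rep a f) : a ≠ 0 ↔ ∀ᶠ y in codiscreteWithin U, f y ≠ 0 := by
  rw [Ne, ha.eq_iff zero]
  refine ⟨(ha.1.eq_zero_or_ne_zero hU.isPreconnected).resolve_left, fun h h' => ?_⟩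
  obtain ⟨y, h1, h2⟩ := (h.and h').exists
  exact h1 h2

theorem ne_iff (ha : M.Rep a f) (hb : M.Rep b g) :
    a ≠ b ↔ ∀ᶠ y in codiscreteWithin U, f y ≠ g y := by
  rw [← sub_ne_zero, (ha.sub hb).ne_zero_iff]
  simp only [sub_ne_zero]

theorem inv (ha : M.Rep a f) : M.Rep a⁻¹ fun y => (f y)⁻¹ := by
  by_cases h : a = 0
  -- The default 0⁻¹ = 0 is the same in the field and pointwise, so no hypothesis a ≠ 0 is needed.
  · rw [h, inv_zero]
    refine zero.congr ha.1.inv ?_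
    filter_upwards [(ha.eq_iff zero).1 h] with y hy
    simp [hy]
  · have hr := M.rep_mk ha.1.inv
    have : a * M.cls ha.1.inv = 1 := by
      rw [(ha.mul hr).eq_iff one]
      filter_upwards [ha.ne_zero_iff.1 h] with y hy
      simp [hy]
    rw [← eq_inv_of_mul_eq_one_right this]
    exact hr

theorem div (ha : M.Rep a f) (hb : M.Rep b g) : M.Rep (a / b) fun y => f y / g y := by
  simpa only [div_eq_mul_inv] using ha.mul hb.inv

end Rep

/-- Differentiation of meromorphic functions. -/
def derivFun (a : F) : F := M.cls (M.exists_rep a).choose_spec.1.deriv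

theorem Rep.derivFun {M : MeroModel U F} {a : F} {f : ℂ → ℂ} (ha : M.Rep a f) :
    M.Rep (M.derivFun a) (deriv f) := by
  have h := (M.exists_rep a).choose_spec
  refine (M.rep_mk _).congr ha.1.deriv ?_
  exact h.1.deriv_eventuallyEq_codiscreteWithin ha.1 ((h.eq_iff ha).1 rfl)

/-- The derivation `d/dy` on the field of meromorphic functions. -/
def derivation : Derivation ℂ F F :=
  Derivation.mk'
    { toFun := M.derivFun
      map_add' := fun a b => by
        obtain ⟨f, hf⟩ := M.exists_rep a
        obtain ⟨g, hg⟩ := M.exists_rep b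
        rw [(hf.add hg).derivFun.eq_iff (hf.derivFun.add hg.derivFun)]
        filter_upwards [hf.1.eventually_codiscreteWithin_analyticAt,
          hg.1.eventually_codiscreteWithin_analyticAt] with y h1 h2
        exact deriv_fun_add h1.differentiableAt h2.differentiableAt
      map_smul' := fun c a => by
        obtain ⟨f, hf⟩ := M.exists_rep a
        rw [Algebra.smul_def, RingHom.id_apply, Algebra.smul_def,
          ((Rep.const (M := M) c).mul hf).derivFun.eq_iff ((Rep.const (M := M) c).mul hf.derivFun)]
        filter_upwards [hf.1.eventually_codiscreteWithin_analyticAt] with y h1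
        exact deriv_const_mul c h1.differentiableAt }
    fun a b => by
      obtain ⟨f, hf⟩ := M.exists_rep a
      obtain ⟨g, hg⟩ := M.exists_rep b
      change M.derivFun (a * b) = a * M.derivFun b + b * M.derivFun a
      rw [(hf.mul hg).derivFun.eq_iff ((hf.mul hg.derivFun).add (hg.mul hf.derivFun))]
      filter_upwards [hf.1.eventually_codiscreteWithin_analyticAt,
        hg.1.eventually_codiscreteWithin_analyticAt] with y h1 h2
      rw [deriv_fun_mul h1.differentiableAt h2.differentiableAt]
      ring

theorem Rep.derivation {M : MeroModel U F} {a : F} {f : ℂ → ℂ} (ha : M.Rep a f) :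
    M.Rep (M.derivation a) (deriv f) := ha.derivFun

end MeroModel

end

/-! ### Dictionary between functions and the differential field -/

noncomputable section

/-- The field generated by the two parameters. -/
abbrev paramField (τ lam : ℝ) : IntermediateField ℚ ℂ :=
  IntermediateField.adjoin ℚ ({(τ : ℂ), (lam : ℂ)} : Set ℂ)

/-- The parameter `τ` in the field generated by the parameters. -/
def paramFst (τ lam : ℝ) : paramField τ lam :=
  ⟨τ, IntermediateField.subset_adjoin _ _ (by simp)⟩

/-- The parameter `λ` in the field generated by the parameters. -/
def paramSnd (τ lam : ℝ) : paramField τ lam :=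
  ⟨lam, IntermediateField.subset_adjoin _ _ (by simp)⟩

theorem coe_latticeExp (τ lam : ℝ) (n m : ℤ) :
    ((latticeExp (paramFst τ lam) n m : paramField τ lam) : ℂ) = exponent τ n m := by
  rw [latticeExp, exponent]
  push_cast
  rfl

namespace MeroModel

variable {U : Set ℂ} {F : Type} [Field F] [Algebra ℂ F] (M : MeroModel U F)
variable (τ lam : ℝ)

/-- The derivation of the field of meromorphic functions over the field of parameters. -/
def paramDerivation : Derivation (paramField τ lam) F F :=
  M.derivation.restrictScalars (paramField τ lam)

/-- The independent variable. -/
def var : F := M.cls (MeromorphicOn.id (U := U))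

theorem rep_var : M.Rep M.var fun z => z := M.rep_mk _

variable {M τ lam}

theorem Rep.algebraMap_param (c : paramField τ lam) :
    M.Rep (algebraMap (paramField τ lam) F c) fun _ => (c : ℂ) := Rep.const (c : ℂ)

theorem Rep.algebraMap_latticeExp (n m : ℤ) :
    M.Rep (algebraMap (paramField τ lam) F (latticeExp (paramFst τ lam) n m))
      fun _ => exponent τ n m := by
  simpa only [coe_latticeExp] using
    Rep.algebraMap_param (M := M) (latticeExp (paramFst τ lam) n m)

theorem Rep.paramDerivation {a : F} {f : ℂ → ℂ} (ha : M.Rep a f) :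
    M.Rep (M.paramDerivation τ lam a) (deriv f) := ha.derivation

/-- Evaluation of polynomials commutes with passing to classes, so an algebraic relation in the
field is a differential equation for H off a discrete set. The constants are restricted to ℚ(τ, λ)
to match `IsGeneric`. -/
theorem isGen_of_isGeneric {h : F} {H : ℂ → ℂ} (hh : M.Rep h H) (hg : IsGeneric U τ lam H) :
    IsGen (M.paramDerivation τ lam) M.var h := by
  rw [IsGen, algebraicIndependent_iff]
  intro P hP
  by_contra hP0
  refine hg P hP0 ?_
  have : ∀ P : MvPolynomial (Fin 3) (paramField τ lam),
      M.Rep (MvPolynomial.aeval ![M.var, h, M.paramDerivation τ lam h] P)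
        fun z => MvPolynomial.aeval ![z, H z, deriv H z] P := by
    intro P
    induction P using MvPolynomial.induction_on with
    | C c => simpa using Rep.algebraMap_param (M := M) c
    | add p q hp hq => simpa only [map_add] using hp.add hq
    | mul_X p i hp =>
      simp only [map_mul, MvPolynomial.aeval_X]
      refine hp.mul ?_
      fin_cases i
      exacts [M.rep_var, hh, hh.paramDerivation]
  exact ((this P).eq_iff .zero).1 hP

theorem eventually_ne_zero {L : ℂ → ℂ} (hL : IsLogBranch L U) :
    ∀ᶠ z in codiscreteWithin U, z ≠ 0 := by
  filter_upwards [self_mem_codiscreteWithin U] with z hz h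
  have := hL.exp_eq z hz
  rw [h] at this
  exact Complex.exp_ne_zero _ this

variable [hU : IsDomainSet U]

theorem meromorphicOn_sqrt {L : ℂ → ℂ} (hL : IsLogBranch L U) :
    MeromorphicOn (fun z => Complex.exp (L z / 2)) U := by
  refine AnalyticOnNhd.meromorphicOn ?_
  exact DifferentiableOn.analyticOnNhd (by have := hL.differentiableOn; fun_prop) hU.isOpen

/-- The square root of the independent variable. -/
def sqrtVar (M : MeroModel U F) {L : ℂ → ℂ} (hL : IsLogBranch L U) : F :=
  M.cls (meromorphicOn_sqrt hL)

theorem rep_sqrtVar {L : ℂ → ℂ} (hL : IsLogBranch L U) :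
    M.Rep (M.sqrtVar hL) fun z => Complex.exp (L z / 2) := M.rep_mk _

variable (M) in
theorem isBase {L : ℂ → ℂ} (hL : IsLogBranch L U) (hτ₁ : τ ≠ 1 / 2) (hτ₂ : τ ≠ -1 / 2) :
    IsBase (M.paramDerivation τ lam) M.var (M.sqrtVar hL) (paramFst τ lam) where
  deriv_y := by
    rw [M.rep_var.paramDerivation.eq_iff Rep.one]
    simp
  y_ne_zero := M.rep_var.ne_zero_iff.2 (eventually_ne_zero hL)
  y_ne_one := (M.rep_var.ne_iff Rep.one).2 (compl_singleton_mem_codiscreteWithin 1)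
  sq_r := by
    rw [((rep_sqrtVar hL).pow 2).eq_iff M.rep_var]
    filter_upwards [self_mem_codiscreteWithin U] with z hz
    rw [← Complex.exp_nat_mul]
    convert hL.exp_eq z hz using 2
    push_cast
    ring
  pos_ne_zero h := by
    have h1 : (1 : ℂ) + 2 * τ = 0 := congrArg (Subtype.val) h
    apply hτ₂
    have : (1 : ℝ) + 2 * τ = 0 := by exact_mod_cast h1
    linarith
  neg_ne_zero h := by
    have h1 : (1 : ℂ) - 2 * τ = 0 := congrArg (Subtype.val) h
    apply hτ₁
    have : (1 : ℝ) - 2 * τ = 0 := by exact_mod_cast h1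
    linarith

variable {n m : ℤ} {s h t : F} {S H T : ℂ → ℂ} {L : ℂ → ℂ}

theorem isQuadraturePair_iff (hs : M.Rep s S) (hh : M.Rep h H) :
    IsQuadraturePair U τ n m S H ↔ IsPair (M.paramDerivation τ lam) M.var
      (algebraMap (paramField τ lam) F (latticeExp (paramFst τ lam) n m)) s h := by
  have hμ := Rep.algebraMap_latticeExp (M := M) (τ := τ) (lam := lam) n m
  have hy := M.rep_var
  have e := (hs.paramDerivation (τ := τ) (lam := lam)).div hs |>.eq_iff
    ((hμ.div hy).mul ((hy.add hh).div (hy.sub hh)))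
  constructor
  · rintro ⟨-, -, h3, h4, h5⟩
    refine ⟨hs.ne_zero_iff.2 h3, hh.ne_zero_iff.2 ?_, (hh.ne_iff .one).2 ?_, (hh.ne_iff hy).2 ?_,
      e.2 h5⟩ <;> filter_upwards [h4] with z hz
    exacts [hz.1, hz.2.1, hz.2.2]
  · rintro ⟨h1, h2, h3, h4, h5⟩
    refine ⟨hs.1, hh.1, hs.ne_zero_iff.1 h1, ?_, e.1 h5⟩
    filter_upwards [hh.ne_zero_iff.1 h2, (hh.ne_iff .one).1 h3, (hh.ne_iff hy).1 h4]
      with z a b c using ⟨a, b, c⟩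

theorem Rep.pviRhs {a b c d y G p : F} {a' b' c' d' y' G' p' : ℂ → ℂ} (ha : M.Rep a a')
    (hb : M.Rep b b') (hc : M.Rep c c') (hd : M.Rep d d') (hy : M.Rep y y') (hG : M.Rep G G')
    (hp : M.Rep p p') : M.Rep (pviRhs a b c d y G p)
      fun z => painleveVIRhs (a' z) (b' z) (c' z) (d' z) (y' z) (G' z) (p' z) := by
  exact (((((Rep.one.div (.ofNat 2)).mul (((Rep.one.div hG).add (Rep.one.div (hG.sub .one))).add
    (Rep.one.div (hG.sub hy)))).mul (hp.pow 2)).sub ((((Rep.one.div hy).add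
    (Rep.one.div (hy.sub .one))).add (Rep.one.div (hG.sub hy))).mul hp)).add
    ((((hG.mul (hG.sub .one)).mul (hG.sub hy)).div ((hy.pow 2).mul ((hy.sub .one).pow 2))).mul
      (((ha.add (hb.mul (hy.div (hG.pow 2)))).add
        (hc.mul ((hy.sub .one).div ((hG.sub .one).pow 2)))).add
        (hd.mul ((hy.mul (hy.sub .one)).div ((hG.sub hy).pow 2))))))

theorem Rep.shiftFst {n m μ lam y r h p s : F} {n' m' μ' lam' y' r' h' p' s' : ℂ → ℂ}
    (hn : M.Rep n n') (hm : M.Rep m m') (hμ : M.Rep μ μ') (hl : M.Rep lam lam') (hy : M.Rep y y')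
    (hr : M.Rep r r') (hh : M.Rep h h') (hp : M.Rep p p') (hs : M.Rep s s') :
    M.Rep (shiftFst n m μ lam y r h p s) fun z =>
      _root_.shiftFst (n' z) (m' z) (μ' z) (lam' z) (y' z) (r' z) (h' z) (p' z) (s' z) := by
  have hq := (hn.sub ((Rep.ofNat 2).mul hμ)).add .one
  have hν := ((Rep.ofNat 2).mul hμ).sub .one
  have hQ := (((hq.pow 2).mul (hh.pow 2)).sub ((((hm.pow 2).add (hq.pow 2)).sub
    ((Rep.ofNat 2).mul hl)).mul hh)).add (hm.pow 2)
  exact (((((hy.mul (hy.sub .one)).mul hp).add ((hν.mul hh).mul (hh.sub .one))).pow 2).sub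
    (((hh.sub hy).pow 2).mul hQ)).div
    (((((((Rep.ofNat 8).mul hμ).mul hν).mul hr).mul (hh.sub hy)).mul (hh.sub .one)).mul hh |>.mul hs)

theorem Rep.shiftSnd {n m μ lam y r h p s : F} {n' m' μ' lam' y' r' h' p' s' : ℂ → ℂ}
    (hn : M.Rep n n') (hm : M.Rep m m') (hμ : M.Rep μ μ') (hl : M.Rep lam lam') (hy : M.Rep y y')
    (hr : M.Rep r r') (hh : M.Rep h h') (hp : M.Rep p p') (hs : M.Rep s s') :
    M.Rep (shiftSnd n m μ lam y r h p s) fun z =>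
      _root_.shiftSnd (n' z) (m' z) (μ' z) (lam' z) (y' z) (r' z) (h' z) (p' z) (s' z) :=
  hm.shiftFst hn hμ hl hy.inv hr.inv hh.inv (((hy.pow 2).mul hp).div (hh.pow 2)) hs

theorem isSiteSolution_iff (hs : M.Rep s S) (hh : M.Rep h H) :
    IsSiteSolution U τ lam n m S H ↔ IsLatticeSite (M.paramDerivation τ lam) M.var
      (paramFst τ lam) (paramSnd τ lam) n m s h := by
  have hμ := Rep.algebraMap_latticeExp (M := M) (τ := τ) (lam := lam) n m
  have hl := Rep.algebraMap_param (M := M) (paramSnd τ lam)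
  have hp := hh.paramDerivation (τ := τ) (lam := lam)
  have hn := Rep.intCast (M := M) n
  have hm := Rep.intCast (M := M) m
  have e := hp.paramDerivation (τ := τ) (lam := lam) |>.eq_iff
    (((hn.pow 2).div (.ofNat 2)).pviRhs ((hm.pow 2).neg.div (.ofNat 2)) hl
      ((Rep.one.div (.ofNat 2)).sub ((Rep.ofNat 2).mul (hμ.pow 2))) M.rep_var hh hp)
  have hd : (1 / 2 : ℂ) - 1 / 8 * (1 + 2 * (-1) ^ (n + m) * (τ : ℂ)) ^ 2 =
      1 / 2 - 2 * exponent τ n m ^ 2 := by rw [exponent]; ring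
  constructor
  · rintro ⟨h1, h2⟩
    refine ⟨(isQuadraturePair_iff hs hh).1 h1, e.2 ?_⟩
    have := h2.equation
    rwa [hd] at this
  · rintro ⟨h1, h2⟩
    have h3 := (isQuadraturePair_iff hs hh).2 h1
    refine ⟨h3, hh.1, h3.nondegenerate, ?_⟩
    rw [hd]
    exact e.1 h2

/-- The coefficients A_i come from completing the square in h': they expand (2μ - 1)² h² (h - 1)² -
(h - y)² Q(h), with Q = `quadQ`. -/
theorem shiftN_eq (μ lam : ℂ) (n m : ℤ) (y r h p s : ℂ) :
    shiftN μ lam n m y r h p s = _root_.shiftFst (n : ℂ) m μ lam y r h p s := by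
  simp only [shiftN, _root_.shiftFst, quadQ, coeffA, Fin.sum_univ_five]
  congr 1
  simp
  ring

theorem shiftM_eq (μ lam : ℂ) (n m : ℤ) {y r h p s : ℂ} (hy : y ≠ 0) (hr : r ^ 2 = y) (h0 : h ≠ 0) :
    shiftM μ lam n m y r h p s = _root_.shiftSnd (n : ℂ) m μ lam y r h p s := by
  rw [shiftSnd_eq _ _ _ _ _ _ hy hr h0]
  simp only [shiftM, coeffA, coeffB, Fin.sum_univ_five]
  congr 1
  have e0 : Fin.rev (0 : Fin 5) = 4 := rfl
  have e1 : Fin.rev (1 : Fin 5) = 3 := rfl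
  have e2 : Fin.rev (2 : Fin 5) = 2 := rfl
  have e3 : Fin.rev (3 : Fin 5) = 1 := rfl
  have e4 : Fin.rev (4 : Fin 5) = 0 := rfl
  simp only [e0, e1, e2, e3, e4]
  simp
  field_simp
  ring

theorem isShiftN_iff (hL : IsLogBranch L U) (hs : M.Rep s S) (hh : M.Rep h H) (ht : M.Rep t T) :
    IsShiftN U L τ lam n m S H T ↔ IsFstShift (M.paramDerivation τ lam) M.var (M.sqrtVar hL)
      (paramFst τ lam) (paramSnd τ lam) n m s h t := by
  rw [IsFstShift, ht.eq_iff ((Rep.intCast n).shiftFst (.intCast m) (.algebraMap_latticeExp n m)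
    (.algebraMap_param _) M.rep_var (rep_sqrtVar hL) hh hh.paramDerivation hs), IsShiftN]
  simp only [shiftN_eq]
  rfl

theorem isShiftM_iff (hL : IsLogBranch L U) (hs : M.Rep s S) (hh : M.Rep h H) (ht : M.Rep t T)
    (hp : IsQuadraturePair U τ n m S H) :
    IsShiftM U L τ lam n m S H T ↔ IsSndShift (M.paramDerivation τ lam) M.var (M.sqrtVar hL)
      (paramFst τ lam) (paramSnd τ lam) n m s h t := by
  rw [IsSndShift, ht.eq_iff ((Rep.intCast n).shiftSnd (.intCast m) (.algebraMap_latticeExp n m)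
    (.algebraMap_param _) M.rep_var (rep_sqrtVar hL) hh hh.paramDerivation hs), IsShiftM]
  refine eventually_congr ?_
  filter_upwards [hp.nondegenerate, self_mem_codiscreteWithin U, eventually_ne_zero hL]
    with z ⟨h0, _, _⟩ hz hz0
  rw [shiftM_eq _ _ _ _ hz0 _ h0]
  · rfl
  · rw [← Complex.exp_nat_mul]
    convert hL.exp_eq z hz using 2
    push_cast
    ring

end MeroModel

end

/-! ### Return from the field to functions and lattice parameters -/

noncomputable section

theorem exponent_comm (τ : ℝ) (n m : ℤ) : exponent τ n m = exponent τ m n := by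
  rw [exponent, exponent, add_comm n m]

theorem exponent_succ_left (τ : ℝ) (n m : ℤ) : exponent τ (n + 1) m = 1 / 2 - exponent τ n m := by
  rw [exponent, exponent, show n + 1 + m = n + m + 1 by ring, zpow_add_one₀ (by simp)]
  ring

theorem exponent_pred_left (τ : ℝ) (n m : ℤ) : exponent τ (n - 1) m = 1 / 2 - exponent τ n m := by
  have := exponent_succ_left τ (n - 1) m
  rw [sub_add_cancel] at this
  linear_combination this

theorem exponent_succ_right (τ : ℝ) (n m : ℤ) :
    exponent τ n (m + 1) = 1 / 2 - exponent τ n m := by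
  rw [exponent_comm, exponent_succ_left, exponent_comm]

theorem exponent_pred_right (τ : ℝ) (n m : ℤ) :
    exponent τ n (m - 1) = 1 / 2 - exponent τ n m := by
  rw [exponent_comm, exponent_pred_left, exponent_comm]

namespace IsLogBranch

variable {L : ℂ → ℂ} {U : Set ℂ}

theorem hasDerivAt (hL : IsLogBranch L U) (hU : IsOpen U) {z : ℂ} (hz : z ∈ U) :
    HasDerivAt L z⁻¹ z := by
  have h1 := (hL.differentiableOn.differentiableAt (hU.mem_nhds hz)).hasDerivAt
  have h2 : HasDerivAt (fun w => Complex.exp (L w)) 1 z :=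
    (hasDerivAt_id z).congr_of_eventuallyEq <| by
      filter_upwards [hU.mem_nhds hz] with w hw using hL.exp_eq w hw
  have h3 := h1.cexp.unique h2
  rw [hL.exp_eq z hz] at h3
  rwa [← eq_inv_of_mul_eq_one_right h3]

theorem ne_zero (hL : IsLogBranch L U) {z : ℂ} (hz : z ∈ U) : z ≠ 0 := by
  rw [← hL.exp_eq z hz]
  exact Complex.exp_ne_zero _

theorem sq_sqrt (hL : IsLogBranch L U) {z : ℂ} (hz : z ∈ U) : Complex.exp (L z / 2) ^ 2 = z := by
  rw [← Complex.exp_nat_mul]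
  convert hL.exp_eq z hz using 2
  push_cast
  ring

end IsLogBranch

/-- Identities in the field hold only off a discrete set; continuity gives them at every point where
the functions involved are holomorphic. -/
theorem eq_of_eventually_codiscreteWithin {U : Set ℂ} (hU : IsOpen U) {x : ℂ} (hx : x ∈ U)
    {f g : ℂ → ℂ} (hf : ContinuousAt f x) (hg : ContinuousAt g x)
    (h : ∀ᶠ y in codiscreteWithin U, f y = g y) : f x = g x :=
  ((hf.eventuallyEq_nhds_iff_eventuallyEq_nhdsNE hg).1
    (eventually_nhdsNE_of_codiscreteWithin hU hx h)).eq_of_nhds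

namespace MeroModel

variable {U : Set ℂ} [hU : IsDomainSet U] {F : Type} [Field F] [Algebra ℂ F] [CharZero F]
variable (M : MeroModel U F) {τ lam : ℝ} (hτ₁ : τ ≠ 1 / 2) (hτ₂ : τ ≠ -1 / 2)
variable {L : ℂ → ℂ} (hL : IsLogBranch L U)
include M hτ₁ hτ₂ hL

theorem isSiteSolution_shift {n m : ℤ} {S H S' H' : ℂ → ℂ} (hs : IsSiteSolution U τ lam n m S H) :
    (IsShiftN U L τ lam n m S H S' → IsQuadraturePair U τ (n + 1) m S' H' →
      IsSiteSolution U τ lam (n + 1) m S' H') ∧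
    (IsShiftM U L τ lam n m S H S' → IsQuadraturePair U τ n (m + 1) S' H' →
      IsSiteSolution U τ lam n (m + 1) S' H') := by
  have hB := M.isBase (lam := lam) hL hτ₁ hτ₂
  have rs := M.rep_mk hs.pair.meromorphicOn_left
  have rh := M.rep_mk hs.pair.meromorphicOn_right
  have hs' := (isSiteSolution_iff rs rh).1 hs
  constructor <;> intro h1 h2 <;> have rs' := M.rep_mk h2.meromorphicOn_left <;>
    have rh' := M.rep_mk h2.meromorphicOn_right <;> rw [isSiteSolution_iff rs' rh']
  · exact (hs'.shiftFst hB ((isShiftN_iff hL rs rh rs').1 h1)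
      ((isQuadraturePair_iff rs' rh').1 h2)).1
  · exact (hs'.shiftSnd hB ((isShiftM_iff hL rs rh rs' hs.pair).1 h1)
      ((isQuadraturePair_iff rs' rh').1 h2)).1

theorem exists_isPainleveVIFamily {n₀ m₀ : ℤ} {S₀ H₀ : ℂ → ℂ}
    (hs : IsSiteSolution U τ lam n₀ m₀ S₀ H₀) (hg : IsGeneric U τ lam H₀) :
    ∃ S H : ℤ → ℤ → ℂ → ℂ, IsPainleveVIFamily U L τ lam S H ∧ S n₀ m₀ = S₀ ∧ H n₀ m₀ = H₀ := by
  have hB := M.isBase (lam := lam) hL hτ₁ hτ₂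
  have rs := M.rep_mk hs.pair.meromorphicOn_left
  have rh := M.rep_mk hs.pair.meromorphicOn_right
  obtain ⟨s, h, h1, h2, h3, h4, h5⟩ := exists_lattice_family hB n₀ m₀ _ _
    ((isSiteSolution_iff rs rh).1 hs) (isGen_of_isGeneric rh hg)
  -- Representatives are arbitrary except at (n₀, m₀), where the given function must be recovered
  -- exactly and not just off a discrete set.
  have key : ∀ (a : ℤ → ℤ → F) (f₀ : ℂ → ℂ), M.Rep (a n₀ m₀) f₀ →
      ∃ f : ℤ → ℤ → ℂ → ℂ, (∀ n m, M.Rep (a n m) (f n m)) ∧ f n₀ m₀ = f₀ := by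
    intro a f₀ hf₀
    have : ∀ n m, ∃ f, M.Rep (a n m) f ∧ (n = n₀ → m = m₀ → f = f₀) := by
      intro n m
      by_cases hnm : n = n₀ ∧ m = m₀
      · obtain ⟨rfl, rfl⟩ := hnm
        exact ⟨f₀, hf₀, fun _ _ => rfl⟩
      · obtain ⟨f, hf⟩ := M.exists_rep (a n m)
        exact ⟨f, hf, fun e1 e2 => absurd ⟨e1, e2⟩ hnm⟩
    choose f hf hf' using this
    exact ⟨f, hf, hf' _ _ rfl rfl⟩
  obtain ⟨S, hS, hS₀⟩ := key s S₀ (by rwa [h4])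
  obtain ⟨H, hH, hH₀⟩ := key h H₀ (by rwa [h5])
  have site : ∀ n m, IsSiteSolution U τ lam n m (S n m) (H n m) := fun n m =>
    (isSiteSolution_iff (hS n m) (hH n m)).2 (h1 n m)
  exact ⟨S, H, ⟨site, fun n m => (isShiftN_iff hL (hS _ _) (hH _ _) (hS _ _)).2 (h2 n m),
    fun n m => (isShiftM_iff hL (hS _ _) (hH _ _) (hS _ _) (site n m).pair).2 (h3 n m)⟩, hS₀, hH₀⟩

variable {S H : ℤ → ℤ → ℂ → ℂ} (hf : IsPainleveVIFamily U L τ lam S H) {n m : ℤ} {x : ℂ}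
include hf

theorem latticeEquation_apply (hx : x ∈ U) (h0 : AnalyticAt ℂ (S n m) x)
    (h1 : AnalyticAt ℂ (S (n + 1) m) x) (h2 : AnalyticAt ℂ (S n (m + 1)) x)
    (h3 : AnalyticAt ℂ (S (n + 1) (m + 1)) x) :
    (S n m x - S (n + 1) (m + 1) x) * (S (n + 1) m x - S n (m + 1) x) * Complex.exp (L x / 2) =
      x - 1 := by
  have hB := M.isBase (lam := lam) hL hτ₁ hτ₂
  have rs := fun n m => M.rep_mk (hf.site n m).pair.meromorphicOn_left
  have rh := fun n m => M.rep_mk (hf.site n m).pair.meromorphicOn_right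
  have hs := fun n m => (isSiteSolution_iff (rs n m) (rh n m)).1 (hf.site n m)
  have hN := fun n m => (isShiftN_iff hL (rs n m) (rh n m) (rs (n + 1) m)).1 (hf.shift_n n m)
  have hM := fun n m =>
    (isShiftM_iff hL (rs n m) (rh n m) (rs n (m + 1)) (hf.site n m).pair).1 (hf.shift_m n m)
  have e := (hs n m).latticeEquation hB (hs (n + 1) m) (hN n m) (hM n m) (hM (n + 1) m)
  have hLc := (hL.hasDerivAt hU.isOpen hx).continuousAt
  have c0 := h0.continuousAt
  have c1 := h1.continuousAt
  have c2 := h2.continuousAt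
  have c3 := h3.continuousAt
  exact eq_of_eventually_codiscreteWithin hU.isOpen hx (by fun_prop) (by fun_prop)
    (((((rs _ _).sub (rs _ _)).mul ((rs _ _).sub (rs _ _))).mul (rep_sqrtVar hL)).eq_iff
      (M.rep_var.sub .one) |>.1 e)

theorem invariance_fst_apply (hx : x ∈ U) (h0 : AnalyticAt ℂ (S n m) x)
    (h1 : AnalyticAt ℂ (S (n + 1) m) x) (h2 : AnalyticAt ℂ (S (n - 1) m) x) :
    (S (n + 1) m x - S (n - 1) m x) * (x * deriv (S n m) x + exponent τ n m * S n m x) =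
      -n * Complex.exp (L x / 2) := by
  have hB := M.isBase (lam := lam) hL hτ₁ hτ₂
  have rs := fun n m => M.rep_mk (hf.site n m).pair.meromorphicOn_left
  have rh := fun n m => M.rep_mk (hf.site n m).pair.meromorphicOn_right
  have hs := fun n m => (isSiteSolution_iff (rs n m) (rh n m)).1 (hf.site n m)
  have hN := fun n m => (isShiftN_iff hL (rs n m) (rh n m) (rs (n + 1) m)).1 (hf.shift_n n m)
  have hN' := hN (n - 1) m
  simp only [sub_add_cancel] at hN'
  have e := (hs n m).invariance_fst hB (hs (n - 1) m) (hN n m) hN'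
  have hLc := (hL.hasDerivAt hU.isOpen hx).continuousAt
  have c0 := h0.continuousAt
  have c0' := h0.deriv.continuousAt
  have c1 := h1.continuousAt
  have c2 := h2.continuousAt
  exact eq_of_eventually_codiscreteWithin hU.isOpen hx (by fun_prop) (by fun_prop)
    ((((rs _ _).sub (rs _ _)).mul ((M.rep_var.mul (rs _ _).paramDerivation).add
      ((Rep.algebraMap_latticeExp n m).mul (rs _ _)))).eq_iff
      ((Rep.intCast n).neg.mul (rep_sqrtVar hL)) |>.1 e)

theorem invariance_snd_apply (hx : x ∈ U) (h0 : AnalyticAt ℂ (S n m) x)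
    (h1 : AnalyticAt ℂ (S n (m + 1)) x) (h2 : AnalyticAt ℂ (S n (m - 1)) x) :
    (S n (m + 1) x - S n (m - 1) x) * (x * deriv (S n m) x - exponent τ n m * S n m x) *
      Complex.exp (L x / 2) = m := by
  have hB := M.isBase (lam := lam) hL hτ₁ hτ₂
  have rs := fun n m => M.rep_mk (hf.site n m).pair.meromorphicOn_left
  have rh := fun n m => M.rep_mk (hf.site n m).pair.meromorphicOn_right
  have hs := fun n m => (isSiteSolution_iff (rs n m) (rh n m)).1 (hf.site n m)
  have hM := fun n m =>
    (isShiftM_iff hL (rs n m) (rh n m) (rs n (m + 1)) (hf.site n m).pair).1 (hf.shift_m n m)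
  have hM' := hM n (m - 1)
  simp only [sub_add_cancel] at hM'
  have e := (hs n m).invariance_snd hB (hs n (m - 1)) (hM n m) hM'
  have hLc := (hL.hasDerivAt hU.isOpen hx).continuousAt
  have c0 := h0.continuousAt
  have c0' := h0.deriv.continuousAt
  have c1 := h1.continuousAt
  have c2 := h2.continuousAt
  exact eq_of_eventually_codiscreteWithin hU.isOpen hx (by fun_prop) (by fun_prop)
    (((((rs _ _).sub (rs _ _)).mul ((M.rep_var.mul (rs _ _).paramDerivation).sub
      ((Rep.algebraMap_latticeExp n m).mul (rs _ _)))).mul (rep_sqrtVar hL)).eq_iff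
      (Rep.intCast m) |>.1 e)

end MeroModel

section Similarity

variable {U V : Set ℂ} {L K : ℂ → ℂ} {τ : ℝ} {S : ℤ → ℤ → ℂ → ℂ} {n m : ℤ} {α β : ℂ}

theorem hasDerivAt_similaritySolution_fst (hV : IsOpen V) (hK : IsLogBranch K V) (hα : α ≠ 0)
    (hβ : β ≠ 0) (hαβ : α * β ∈ V) (hS : AnalyticAt ℂ (S n m) (α / β)) :
    HasDerivAt (fun a => similaritySolution K τ S n m a β)
      (Complex.exp (exponent τ n m * K (α * β)) / α *
        (α / β * deriv (S n m) (α / β) + exponent τ n m * S n m (α / β))) α := by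
  have h1 := hS.differentiableAt.hasDerivAt.comp α ((hasDerivAt_id α).div_const β)
  have h2 := (((hK.hasDerivAt hV hαβ).comp α ((hasDerivAt_id α).mul_const β)).const_mul
    (exponent τ n m)).cexp
  refine (h1.mul h2).congr_deriv ?_
  simp
  field_simp

theorem hasDerivAt_similaritySolution_snd (hV : IsOpen V) (hK : IsLogBranch K V) (hα : α ≠ 0)
    (hβ : β ≠ 0) (hαβ : α * β ∈ V) (hS : AnalyticAt ℂ (S n m) (α / β)) :
    HasDerivAt (fun b => similaritySolution K τ S n m α b)
      (-(Complex.exp (exponent τ n m * K (α * β)) / β) *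
        (α / β * deriv (S n m) (α / β) - exponent τ n m * S n m (α / β))) β := by
  have h1 := hS.differentiableAt.hasDerivAt.comp β ((hasDerivAt_inv hβ).const_mul α)
  have h2 := (((hK.hasDerivAt hV hαβ).comp β ((hasDerivAt_id β).const_mul α)).const_mul
    (exponent τ n m)).cexp
  refine (h1.mul h2).congr_deriv ?_
  simp
  field_simp
  ring

theorem differentiableAt_similaritySolution (hV : IsOpen V) (hK : IsLogBranch K V) (hβ : β ≠ 0)
    (hαβ : α * β ∈ V) (hS : AnalyticAt ℂ (S n m) (α / β)) :
    DifferentiableAt ℂ (fun p : ℂ × ℂ => similaritySolution K τ S n m p.1 p.2) (α, β) := by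
  have h1 : DifferentiableAt ℂ (fun p : ℂ × ℂ => S n m (p.1 / p.2)) (α, β) :=
    hS.differentiableAt.comp (α, β) (f := fun p : ℂ × ℂ => p.1 / p.2)
      (by simpa only [div_eq_mul_inv] using
        differentiableAt_fst.fun_mul (differentiableAt_snd.fun_inv hβ))
  have h2 : DifferentiableAt ℂ (fun p : ℂ × ℂ => K (p.1 * p.2)) (α, β) :=
    (hK.hasDerivAt hV hαβ).differentiableAt.comp (α, β) (f := fun p : ℂ × ℂ => p.1 * p.2)
      (differentiableAt_fst.mul differentiableAt_snd)
  exact h1.mul (h2.const_mul _).cexp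

theorem exp_half_sub_mul (μ z : ℂ) :
    Complex.exp ((1 / 2 - μ) * z) * Complex.exp (μ * z) = Complex.exp (z / 2) := by
  rw [← Complex.exp_add]
  ring_nf

/-- Neighbouring sites have exponents μ and 1/2 - μ, so each product of powers in the three
equations is E = √(αβ). Consistency of branches, r E = α with r² = α / β, also gives E = r β. -/
theorem isContinuouslyInvariantH1At_similaritySolution (hV : IsOpen V) (hL : IsLogBranch L U)
    (hK : IsLogBranch K V) (hαβ : (α, β) ∈ parameterDomain L U K V)
    (hS : AnalyticAt ℂ (S n m) (α / β))
    (e1 : (S n m (α / β) - S (n + 1) (m + 1) (α / β)) *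
      (S (n + 1) m (α / β) - S n (m + 1) (α / β)) * Complex.exp (L (α / β) / 2) = α / β - 1)
    (e2 : (S (n + 1) m (α / β) - S (n - 1) m (α / β)) * (α / β * deriv (S n m) (α / β) +
      exponent τ n m * S n m (α / β)) = -n * Complex.exp (L (α / β) / 2))
    (e3 : (S n (m + 1) (α / β) - S n (m - 1) (α / β)) * (α / β * deriv (S n m) (α / β) -
      exponent τ n m * S n m (α / β)) * Complex.exp (L (α / β) / 2) = m) :
    IsContinuouslyInvariantH1At (similaritySolution K τ S) n m α β := by
  obtain ⟨hx, hz, hE⟩ := hαβ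
  dsimp only at hx hz hE
  have hα : α ≠ 0 := left_ne_zero_of_mul (hK.ne_zero hz)
  have hβ : β ≠ 0 := right_ne_zero_of_mul (hK.ne_zero hz)
  have hr := hL.sq_sqrt hx
  have he := exp_half_sub_mul (exponent τ n m) (K (α * β))
  have hc : exponent τ (n + 1) (m + 1) = exponent τ n m := by
    rw [exponent_succ_left, exponent_succ_right]; ring
  have hr0 : Complex.exp (L (α / β) / 2) ≠ 0 := Complex.exp_ne_zero _
  refine ⟨?_, differentiableAt_similaritySolution hV hK hβ hz hS, ?_, ?_⟩
  · simp only [similaritySolution, hc, exponent_succ_left, exponent_succ_right]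
    generalize Complex.exp (L (α / β) / 2) = r at *
    generalize Complex.exp ((1 / 2 - exponent τ n m) * K (α * β)) = e' at *
    generalize Complex.exp (exponent τ n m * K (α * β)) = e at *
    generalize Complex.exp (K (α * β) / 2) = E at *
    have h4 : r ^ 2 * β = α := by rw [hr]; field_simp
    have h5 : E = r * β := by
      apply mul_left_cancel₀ hr0
      linear_combination hE - h4
    rw [h5] at he
    rw [eq_sub_iff_add_eq, eq_div_iff hβ] at e1
    linear_combination (S n m (α / β) - S (n + 1) (m + 1) (α / β)) *
      (S (n + 1) m (α / β) - S n (m + 1) (α / β)) * he + e1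
  · rw [(hasDerivAt_similaritySolution_fst hV hK hα hβ hz hS).deriv]
    simp only [similaritySolution, exponent_succ_left, exponent_pred_left]
    generalize Complex.exp (L (α / β) / 2) = r at *
    generalize Complex.exp ((1 / 2 - exponent τ n m) * K (α * β)) = e' at *
    generalize Complex.exp (exponent τ n m * K (α * β)) = e at *
    generalize Complex.exp (K (α * β) / 2) = E at *
    calc _ = (S (n + 1) m (α / β) - S (n - 1) m (α / β)) * (α / β * deriv (S n m) (α / β) +
          exponent τ n m * S n m (α / β)) * (e' * e) / α + n := by ring
      _ = 0 := by rw [e2, he, mul_assoc, hE]; field_simp; ring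
  · rw [(hasDerivAt_similaritySolution_snd hV hK hα hβ hz hS).deriv]
    simp only [similaritySolution, exponent_succ_right, exponent_pred_right]
    generalize Complex.exp (L (α / β) / 2) = r at *
    generalize Complex.exp ((1 / 2 - exponent τ n m) * K (α * β)) = e' at *
    generalize Complex.exp (exponent τ n m * K (α * β)) = e at *
    generalize Complex.exp (K (α * β) / 2) = E at *
    have h4 : r ^ 2 * β = α := by rw [hr]; field_simp
    have h5 : E = r * β := by
      apply mul_left_cancel₀ hr0
      linear_combination hE - h4
    calc _ = -((S n (m + 1) (α / β) - S n (m - 1) (α / β)) * (α / β * deriv (S n m) (α / β) -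
          exponent τ n m * S n m (α / β))) * (e' * e) / β + m := by ring
      _ = 0 := by
        rw [he, h5, ← e3]
        field_simp
        ring

end Similarity

end

theorem mainTheorem6 (τ lam : ℝ) (hτ₁ : τ ≠ 1 / 2) (hτ₂ : τ ≠ -1 / 2)
    (U V : Set ℂ) (hU : IsOpen U) (hUc : IsPreconnected U) (hV : IsOpen V)
    (L K : ℂ → ℂ) (hL : IsLogBranch L U) (hK : IsLogBranch K V) :
    (∀ S H : ℤ → ℤ → ℂ → ℂ, IsPainleveVIFamily U L τ lam S H →
      ∀ (n m : ℤ) (α β : ℂ), (α, β) ∈ parameterDomain L U K V →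
        AnalyticAt ℂ (S n m) (α / β) →
        AnalyticAt ℂ (S (n + 1) m) (α / β) → AnalyticAt ℂ (S n (m + 1)) (α / β) →
        AnalyticAt ℂ (S (n + 1) (m + 1)) (α / β) →
        AnalyticAt ℂ (S (n - 1) m) (α / β) → AnalyticAt ℂ (S n (m - 1)) (α / β) →
        IsContinuouslyInvariantH1At (similaritySolution K τ S) n m α β) ∧
    (∀ (n₀ m₀ : ℤ) (S₀ H₀ : ℂ → ℂ), IsSiteSolution U τ lam n₀ m₀ S₀ H₀ →
      IsGeneric U τ lam H₀ →
      ∃ S H : ℤ → ℤ → ℂ → ℂ, IsPainleveVIFamily U L τ lam S H ∧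
        S n₀ m₀ = S₀ ∧ H n₀ m₀ = H₀) ∧
    (∀ (n m : ℤ) (S H S' H' : ℂ → ℂ), IsSiteSolution U τ lam n m S H →
      (IsShiftN U L τ lam n m S H S' → IsQuadraturePair U τ (n + 1) m S' H' →
        IsSiteSolution U τ lam (n + 1) m S' H') ∧
      (IsShiftM U L τ lam n m S H S' → IsQuadraturePair U τ n (m + 1) S' H' →
        IsSiteSolution U τ lam n (m + 1) S' H')) := by
  -- `IsPreconnected` admits the empty set. There every property off a discrete set holds, so no
  -- function is generic (take P = 1) and there are no lattice parameters.
  rcases U.eq_empty_or_nonempty with rfl | hne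
  · have hbot : codiscreteWithin (∅ : Set ℂ) = ⊥ := by simp [codiscreteWithin]
    refine ⟨fun _ _ _ _ _ _ _ h => absurd h.1 (Set.notMem_empty _), fun n₀ m₀ S₀ H₀ _ hg => ?_,
      fun n m S H S' H' _ => ⟨fun _ hp => ⟨hp, ?_⟩, fun _ hp => ⟨hp, ?_⟩⟩⟩
    · exact absurd (by rw [hbot]; exact eventually_bot) (hg 1 one_ne_zero)
    all_goals exact ⟨hp.2, hp.4, by rw [hbot]; exact eventually_bot⟩
  · have : IsDomainSet U := ⟨hU, hUc, hne⟩
    obtain ⟨F, _, _, ⟨M⟩⟩ := exists_meroModel U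
    have : CharZero F := charZero_of_injective_algebraMap (algebraMap ℂ F).injective
    refine ⟨fun S H hf n m α β hαβ a0 a1 a2 a3 a4 a5 => ?_, fun n₀ m₀ S₀ H₀ hs hg =>
      M.exists_isPainleveVIFamily hτ₁ hτ₂ hL hs hg, fun n m S H S' H' hs =>
      M.isSiteSolution_shift hτ₁ hτ₂ hL hs⟩
    exact isContinuouslyInvariantH1At_similaritySolution hV hL hK hαβ a0
      (M.latticeEquation_apply hτ₁ hτ₂ hL hf hαβ.1 a0 a1 a2 a3)
      (M.invariance_fst_apply hτ₁ hτ₂ hL hf hαβ.1 a0 a1 a4)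
      (M.invariance_snd_apply hτ₁ hτ₂ hL hf hαβ.1 a0 a2 a5)
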